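/- Let $p\ge 1$, $0<T<\infty$, $j=\begin{bmatrix} I_p&0\\0&-I_p\end{bmatrix}$, and let $\beta$ be a $p\times 2p$ complex matrix function on $[0,T]$ which is two times differentiable with $\beta''\in L_2^{p\times 2p}(0,T)$ (that is, $\beta$ is differentiable on $[0,T]$, $\beta'$ is absolutely continuous, and the entries of $\beta''$ are square-integrable; this includes every $\beta$ which is two times differentiable at each point of $[0,T]$ and has square-integrable $\beta''$). Suppose that $$\beta(x)j\beta(x)^*= 0,\qquad \beta'(x)j\beta(x)^*= \mathrm{i} I_p\qquad (0\le x\le T).$$ Consider on $L_2^p(0,T)$ (the square-integrable functions on $(0,T)$ with values in $\mathbb{C}^p$) the bounded operators $$(Kf)(x)=\mathrm{i}\beta(x)j\int_0^x\beta(t)^*f(t)\,dt,\qquad (Af)(x)=\int_0^x(t-x)f(t)\,dt .$$ Then $K$ is linearly similar to $A$: there is a bounded and boundedly invertible operator $V$ on $L_2^p(0,T)$ such that $K=VAV^{-1}$. Moreover, $V$ can be chosen of the form $$(Vf)(x)=u(x)\Big(f(x)+\int_0^x\mathcal{V}(x,t)f(t)\,dt\Big),$$ where $u$ is a $p\times p$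 matrix function which is unitary ($u(x)^*=u(x)^{-1}$) for all $x \in [0,T]$ and absolutely continuous on $[0,T]$, and where $\mathcal{V}(x,t)$ is a measurable $p\times p$ matrix kernel with $$\sup_{0\le t\le x\le T}\|\mathcal{V}(x,t)\|<\infty .$$ -/

import Mathlib

open MeasureTheory Set Matrix
open scoped Matrix.Norms.L2Operator

/-- The Hilbert space `L_2^p(0,T)` of (classes of) square-integrable functions on `(0,T)` with
values in the column vectors `ℂ^p` with their Euclidean norm. -/
abbrev L2vec (p : ℕ) (T : ℝ) : Type :=
  Lp (EuclideanSpace ℂ (Fin p)) 2 (volume.restrict (Ioo (0 : ℝ) T))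

/-- The `2p × 2p` matrix `j = diag(I_p, -I_p)`. -/
def jMat (p : ℕ) : Matrix (Fin p ⊕ Fin p) (Fin p ⊕ Fin p) ℂ :=
  Matrix.fromBlocks 1 0 0 (-1)

/-- The closed triangle `0 ≤ t ≤ x ≤ T` in the plane of points `(x,t)`. -/
def triangle (T : ℝ) : Set (ℝ × ℝ) := {z | 0 ≤ z.2 ∧ z.2 ≤ z.1 ∧ z.1 ≤ T}

/-- A `p × p` matrix kernel `k(x,t)` which is (Lebesgue) measurable on the triangle
`0 ≤ t ≤ x ≤ T` and satisfies `sup ‖k(x,t)‖ < ∞` there. The norm of a matrix is its operator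
norm with respect to the Euclidean norm. -/
structure IsBddKernel {p : ℕ} (T : ℝ) (k : ℝ → ℝ → Matrix (Fin p) (Fin p) ℂ) : Prop where
  aestronglyMeasurable :
    AEStronglyMeasurable (fun z : ℝ × ℝ => k z.1 z.2) (volume.restrict (triangle T))
  bounded : ∃ C : ℝ, ∀ x t : ℝ, 0 ≤ t → t ≤ x → x ≤ T → ‖k x t‖ ≤ C

/-- `(∫_0^x k(x,t) · dt) f`, as a function of `x`. -/
noncomputable def volterraFun {p : ℕ} (k : ℝ → ℝ → Matrix (Fin p) (Fin p) ℂ)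
    (f : ℝ → EuclideanSpace ℂ (Fin p)) (x : ℝ) : EuclideanSpace ℂ (Fin p) :=
  ∫ t in (0 : ℝ)..x, Matrix.toEuclideanLin (k x t) (f t)

theorem measurableSet_triangle (T : ℝ) : MeasurableSet (triangle T) := by
  refine ((isClosed_le continuous_const continuous_snd).inter
    ((isClosed_le continuous_snd continuous_fst).inter
      (isClosed_le continuous_fst continuous_const))).measurableSet

/-- The continuous bilinear map `(M, v) ↦ M v`. -/
noncomputable def mulVecBilin (p : ℕ) :
    Matrix (Fin p) (Fin p) ℂ →L[ℂ] EuclideanSpace ℂ (Fin p) →L[ℂ] EuclideanSpace ℂ (Fin p) :=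
  LinearMap.mkContinuous₂
    (LinearMap.mk₂ ℂ (fun (M : Matrix (Fin p) (Fin p) ℂ) (v : EuclideanSpace ℂ (Fin p)) =>
        Matrix.toEuclideanLin M v)
      (by intros; simp) (by intros; simp) (by intros; simp) (by intros; simp)) 1
    (by intro M v; simpa [Matrix.toLpLin_apply] using Matrix.l2_opNorm_mulVec M v)

theorem norm_toEuclideanLin_le {p : ℕ} (M : Matrix (Fin p) (Fin p) ℂ)
    (v : EuclideanSpace ℂ (Fin p)) : ‖Matrix.toEuclideanLin M v‖ ≤ ‖M‖ * ‖v‖ := by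
  simpa [Matrix.toLpLin_apply] using Matrix.l2_opNorm_mulVec M v

section
variable {p : ℕ} {T : ℝ} {k : ℝ → ℝ → Matrix (Fin p) (Fin p) ℂ}

theorem volterraFun_eq {f : ℝ → EuclideanSpace ℂ (Fin p)} {x : ℝ} (hx : x ∈ Ioo (0 : ℝ) T) :
    volterraFun k f x = ∫ t in Ioo (0 : ℝ) T,
      (triangle T).indicator (fun z => Matrix.toEuclideanLin (k z.1 z.2) (f z.2)) (x, t) := by
  have h1 : ∀ t : ℝ, (Ioo (0 : ℝ) T).indicator (fun t => (triangle T).indicator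
      (fun z => Matrix.toEuclideanLin (k z.1 z.2) (f z.2)) (x, t)) t =
      (Ioc (0 : ℝ) x).indicator (fun t => Matrix.toEuclideanLin (k x t) (f t)) t := by
    intro t
    by_cases ht : t ∈ Ioc (0 : ℝ) x
    · have h2 : t ∈ Ioo (0 : ℝ) T := ⟨ht.1, ht.2.trans_lt hx.2⟩
      have h3 : (x, t) ∈ triangle T := ⟨ht.1.le, ht.2, hx.2.le⟩
      rw [indicator_of_mem ht, indicator_of_mem h2, indicator_of_mem h3]
    · rw [indicator_of_notMem ht]
      by_cases h2 : t ∈ Ioo (0 : ℝ) T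
      · rw [indicator_of_mem h2, indicator_of_notMem]
        intro h3
        exact ht ⟨h2.1, h3.2.1⟩
      · rw [indicator_of_notMem h2]
  rw [volterraFun, intervalIntegral.integral_of_le hx.1.le, ← integral_indicator measurableSet_Ioc,
    ← integral_indicator measurableSet_Ioo]
  exact integral_congr_ae (Filter.Eventually.of_forall fun t => (h1 t).symm)

theorem indicator_kernel_aestronglyMeasurable (hk : IsBddKernel T k)
    {f : ℝ → EuclideanSpace ℂ (Fin p)}
    (hf : AEStronglyMeasurable f (volume.restrict (Ioo (0 : ℝ) T))) :
    AEStronglyMeasurable ((triangle T).indicator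
      (fun z : ℝ × ℝ => Matrix.toEuclideanLin (k z.1 z.2) (f z.2)))
      ((volume.restrict (Ioo (0 : ℝ) T)).prod (volume.restrict (Ioo (0 : ℝ) T))) := by
  rw [aestronglyMeasurable_indicator_iff (measurableSet_triangle T)]
  have ha : AEStronglyMeasurable (fun z : ℝ × ℝ => k z.1 z.2)
      (((volume.restrict (Ioo (0 : ℝ) T)).prod (volume.restrict (Ioo (0 : ℝ) T))).restrict
        (triangle T)) := by
    refine hk.aestronglyMeasurable.mono_measure (Measure.restrict_mono_measure ?_ _)
    rw [Measure.prod_restrict]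
    exact Measure.restrict_le_self
  have hb := (hf.comp_snd (μ := volume.restrict (Ioo (0 : ℝ) T))).restrict (s := triangle T)
  exact (mulVecBilin p).aestronglyMeasurable_comp₂ ha hb

theorem volterraFun_aestronglyMeasurable (hk : IsBddKernel T k)
    {f : ℝ → EuclideanSpace ℂ (Fin p)}
    (hf : AEStronglyMeasurable f (volume.restrict (Ioo (0 : ℝ) T))) :
    AEStronglyMeasurable (volterraFun k f) (volume.restrict (Ioo (0 : ℝ) T)) := by
  refine (indicator_kernel_aestronglyMeasurable hk hf).integral_prod_right'.congr ?_
  filter_upwards [ae_restrict_mem measurableSet_Ioo] with x hx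
  exact (volterraFun_eq hx).symm

theorem L2vec_integrable (f : L2vec p T) :
    Integrable (f : ℝ → EuclideanSpace ℂ (Fin p)) (volume.restrict (Ioo (0 : ℝ) T)) :=
  (Lp.memLp f).integrable (by norm_num)

theorem integral_norm_L2vec_le (f : L2vec p T) :
    ∫ t in Ioo (0 : ℝ) T, ‖f t‖ ≤ (volume (Ioo (0 : ℝ) T)).toReal ^ (1 / 2 : ℝ) * ‖f‖ := by
  have h := eLpNorm_le_eLpNorm_mul_rpow_measure_univ (p := 1) (q := 2)
    (μ := volume.restrict (Ioo (0 : ℝ) T)) (by norm_num) (Lp.aestronglyMeasurable f)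
  have hfin : eLpNorm f 2 (volume.restrict (Ioo (0 : ℝ) T)) *
      (volume.restrict (Ioo (0 : ℝ) T)) univ ^ (1 / (1 : ENNReal).toReal - 1 / (2 : ENNReal).toReal)
        ≠ ⊤ := by
    refine ENNReal.mul_ne_top (Lp.eLpNorm_ne_top f) (ENNReal.rpow_ne_top_of_nonneg ?_ ?_)
    · norm_num
    · simp
  have h2 := ENNReal.toReal_mono hfin h
  rw [eLpNorm_one_eq_lintegral_enorm, ← integral_norm_eq_lintegral_enorm
    (Lp.aestronglyMeasurable f), ENNReal.toReal_mul, ← ENNReal.toReal_rpow, ← Lp.norm_def] at h2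
  rw [mul_comm]
  refine h2.trans (le_of_eq ?_)
  simp only [Measure.restrict_apply_univ, ENNReal.toReal_one, ENNReal.toReal_ofNat]
  norm_num

theorem norm_indicator_kernel_le {C : ℝ}
    (hC : ∀ x t : ℝ, 0 ≤ t → t ≤ x → x ≤ T → ‖k x t‖ ≤ C)
    (f : ℝ → EuclideanSpace ℂ (Fin p)) (z : ℝ × ℝ) :
    ‖(triangle T).indicator (fun z => Matrix.toEuclideanLin (k z.1 z.2) (f z.2)) z‖
      ≤ |C| * ‖f z.2‖ := by
  by_cases hz : z ∈ triangle T
  · rw [indicator_of_mem hz]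
    exact (norm_toEuclideanLin_le _ _).trans (mul_le_mul_of_nonneg_right
      ((hC _ _ hz.1 hz.2.1 hz.2.2).trans (le_abs_self C)) (norm_nonneg _))
  · rw [indicator_of_notMem hz, norm_zero]
    positivity

theorem integrable_indicator_kernel (hk : IsBddKernel T k) (f : L2vec p T) :
    ∀ᵐ x ∂(volume.restrict (Ioo (0 : ℝ) T)), Integrable (fun t => (triangle T).indicator
      (fun z => Matrix.toEuclideanLin (k z.1 z.2) (f z.2)) (x, t))
      (volume.restrict (Ioo (0 : ℝ) T)) := by
  obtain ⟨C, hC⟩ := hk.bounded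
  have hdom : Integrable (fun z : ℝ × ℝ => |C| * ‖f z.2‖)
      ((volume.restrict (Ioo (0 : ℝ) T)).prod (volume.restrict (Ioo (0 : ℝ) T))) :=
    ((L2vec_integrable f).comp_snd _).norm.const_mul _
  have h := hdom.mono' (indicator_kernel_aestronglyMeasurable hk (Lp.aestronglyMeasurable f))
    (Filter.Eventually.of_forall (norm_indicator_kernel_le hC f))
  exact h.prod_right_ae

theorem norm_volterraFun_le {C : ℝ}
    (hC : ∀ x t : ℝ, 0 ≤ t → t ≤ x → x ≤ T → ‖k x t‖ ≤ C) (f : L2vec p T) :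
    ∀ᵐ x ∂(volume.restrict (Ioo (0 : ℝ) T)), ‖volterraFun k f x‖ ≤
      |C| * ((volume (Ioo (0 : ℝ) T)).toReal ^ (1 / 2 : ℝ) * ‖f‖) := by
  filter_upwards [ae_restrict_mem measurableSet_Ioo] with x hx
  rw [volterraFun_eq hx]
  refine (norm_integral_le_of_norm_le ((L2vec_integrable f).norm.const_mul |C|)
    (Filter.Eventually.of_forall fun t => norm_indicator_kernel_le hC f (x, t))).trans ?_
  rw [integral_const_mul]
  exact mul_le_mul_of_nonneg_left (integral_norm_L2vec_le f) (abs_nonneg C)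

theorem volterraFun_memLp (hk : IsBddKernel T k) (f : L2vec p T) :
    MemLp (volterraFun k f) 2 (volume.restrict (Ioo (0 : ℝ) T)) := by
  obtain ⟨C, hC⟩ := hk.bounded
  exact MemLp.of_bound (volterraFun_aestronglyMeasurable hk (Lp.aestronglyMeasurable f)) _
    (norm_volterraFun_le hC f)

theorem volterraFun_add (hk : IsBddKernel T k) (f g : L2vec p T) :
    volterraFun k (f + g : L2vec p T) =ᵐ[volume.restrict (Ioo (0 : ℝ) T)]
      volterraFun k f + volterraFun k g := by
  filter_upwards [ae_restrict_mem measurableSet_Ioo, integrable_indicator_kernel hk f,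
    integrable_indicator_kernel hk g] with x hx hf hg
  rw [Pi.add_apply, volterraFun_eq hx, volterraFun_eq hx, volterraFun_eq hx, ← integral_add hf hg]
  refine integral_congr_ae ?_
  filter_upwards [Lp.coeFn_add f g] with t ht
  by_cases hz : (x, t) ∈ triangle T
  · simp only [indicator_of_mem hz, ht, Pi.add_apply, map_add]
  · simp only [indicator_of_notMem hz, add_zero]

theorem volterraFun_smul (c : ℂ) (f : L2vec p T) :
    volterraFun k (c • f : L2vec p T) =ᵐ[volume.restrict (Ioo (0 : ℝ) T)]
      c • volterraFun k f := by
  filter_upwards [ae_restrict_mem measurableSet_Ioo] with x hx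
  rw [Pi.smul_apply, volterraFun_eq hx, volterraFun_eq hx, ← integral_smul]
  refine integral_congr_ae ?_
  filter_upwards [Lp.coeFn_smul c f] with t ht
  by_cases hz : (x, t) ∈ triangle T
  · simp only [indicator_of_mem hz, ht, Pi.smul_apply, map_smul]
  · simp only [indicator_of_notMem hz, smul_zero]

/-- The bounded operator `∫_0^x k(x,t) · dt` on `L_2^p(0,T)`, for a bounded kernel `k`. -/
noncomputable def volterraOp {p : ℕ} (T : ℝ) (k : ℝ → ℝ → Matrix (Fin p) (Fin p) ℂ)
    (hk : IsBddKernel T k) : L2vec p T →L[ℂ] L2vec p T :=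
  LinearMap.mkContinuousOfExistsBound
    { toFun := fun f => (volterraFun_memLp hk f).toLp (volterraFun k f)
      map_add' := fun f g => by
        rw [← MemLp.toLp_add]
        exact MemLp.toLp_congr _ _ (volterraFun_add hk f g)
      map_smul' := fun c f => by
        rw [RingHom.id_apply, ← MemLp.toLp_const_smul]
        exact MemLp.toLp_congr _ _ (volterraFun_smul c f) }
    (by
      obtain ⟨C, hC⟩ := hk.bounded
      refine ⟨(volume.restrict (Ioo (0 : ℝ) T)).real univ ^ ((2 : ENNReal).toReal⁻¹) *
        (|C| * (volume (Ioo (0 : ℝ) T)).toReal ^ (1 / 2 : ℝ)), fun f => ?_⟩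
      have h0 : 0 ≤ |C| * ((volume (Ioo (0 : ℝ) T)).toReal ^ (1 / 2 : ℝ) * ‖f‖) := by positivity
      have h := Lp.norm_le_of_ae_bound (p := 2) (f := (volterraFun_memLp hk f).toLp
        (volterraFun k f)) h0 (by
          filter_upwards [norm_volterraFun_le hC f, MemLp.coeFn_toLp (volterraFun_memLp hk f)]
            with x hx hx'
          rw [hx']
          exact hx)
      refine h.trans (le_of_eq ?_)
      simp only [measureUnivNNReal, Measure.real, ENNReal.coe_toNNReal_eq_toReal]
      ring)

theorem volterraOp_coeFn (hk : IsBddKernel T k) (f : L2vec p T) :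
    volterraOp T k hk f =ᵐ[volume.restrict (Ioo (0 : ℝ) T)] volterraFun k f :=
  MemLp.coeFn_toLp (volterraFun_memLp hk f)

theorem IsBddKernel.of_continuousOn
    (hk : ContinuousOn (fun z : ℝ × ℝ => k z.1 z.2) (triangle T)) : IsBddKernel T k := by
  refine ⟨hk.aestronglyMeasurable (measurableSet_triangle T), ?_⟩
  have hcpt : IsCompact (triangle T) := by
    refine (isCompact_Icc (a := ((0 : ℝ), (0 : ℝ))) (b := (T, T))).of_isClosed_subset
      ((isClosed_le continuous_const continuous_snd).inter
        ((isClosed_le continuous_snd continuous_fst).inter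
          (isClosed_le continuous_fst continuous_const))) ?_
    intro z hz
    exact ⟨⟨hz.1.trans hz.2.1, hz.1⟩, ⟨hz.2.2, hz.2.1.trans hz.2.2⟩⟩
  obtain ⟨C, hC⟩ := hcpt.exists_bound_of_continuousOn hk
  exact ⟨C, fun x t h0 h1 h2 => hC (x, t) ⟨h0, h1, h2⟩⟩
end

/-- `β` is two times differentiable on `[0,T]` with first derivative `β'` and with
square-integrable second derivative `β''`: all entries of `β` are differentiable on `[0,T]`
(one-sidedly at the end points), the entries of `β'` are absolutely continuous on `[0,T]`, namely
they are integrals of the entries of `β''`, and the entries of `β''` belong to `L_2(0,T)`. -/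
structure HasL2SecondDeriv {m n : Type*} (T : ℝ) (β β' β'' : ℝ → Matrix m n ℂ) : Prop where
  hasDeriv : ∀ x ∈ Icc (0 : ℝ) T, ∀ a b,
    HasDerivWithinAt (fun y => β y a b) (β' x a b) (Icc (0 : ℝ) T) x
  eq_integral : ∀ x ∈ Icc (0 : ℝ) T, ∀ a b, β' x a b = β' 0 a b + ∫ t in (0 : ℝ)..x, β'' t a b
  memLp : ∀ a b, MemLp (fun x => β'' x a b) 2 (volume.restrict (Ioo (0 : ℝ) T))

/-- Functions which are two times differentiable at every point, with square-integrable second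
derivative, are covered. -/
theorem HasL2SecondDeriv.of_hasDerivWithinAt {m n : Type*} {T : ℝ} {β β' β'' : ℝ → Matrix m n ℂ}
    (h1 : ∀ x ∈ Icc (0 : ℝ) T, ∀ a b,
      HasDerivWithinAt (fun y => β y a b) (β' x a b) (Icc (0 : ℝ) T) x)
    (h2 : ∀ x ∈ Icc (0 : ℝ) T, ∀ a b,
      HasDerivWithinAt (fun y => β' y a b) (β'' x a b) (Icc (0 : ℝ) T) x)
    (h3 : ∀ a b, MemLp (fun x => β'' x a b) 2 (volume.restrict (Ioo (0 : ℝ) T))) :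
    HasL2SecondDeriv T β β' β'' := by
  refine ⟨h1, fun x hx a b => ?_, h3⟩
  have hI : IntegrableOn (fun x => β'' x a b) (Ioc (0 : ℝ) T) := by
    rw [integrableOn_Ioc_iff_integrableOn_Ioo]
    exact (h3 a b).integrable (by norm_num)
  have h := intervalIntegral.integral_eq_sub_of_hasDerivAt_of_le (a := 0) (b := x) hx.1
    (f := fun y => β' y a b) (f' := fun y => β'' y a b)
    (fun y hy => ((h2 y ⟨hy.1, hy.2.trans hx.2⟩ a b).continuousWithinAt).mono
      (Icc_subset_Icc_right hx.2))
    (fun y hy => (h2 y ⟨hy.1.le, hy.2.le.trans hx.2⟩ a b).hasDerivAt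
      (Icc_mem_nhds hy.1 (hy.2.trans_le hx.2)))
    ((intervalIntegrable_iff_integrableOn_Ioc_of_le hx.1).2
      (hI.mono_set (Ioc_subset_Ioc_right hx.2)))
  rw [h]
  ring

theorem HasL2SecondDeriv.continuousOn {m n : Type*} {T : ℝ} {β β' β'' : ℝ → Matrix m n ℂ}
    (h : HasL2SecondDeriv T β β' β'') : ContinuousOn β (Icc (0 : ℝ) T) :=
  continuousOn_pi.2 fun a => continuousOn_pi.2 fun b => fun x hx =>
    (h.hasDeriv x hx a b).continuousWithinAt

/-- The kernel `i β(x) j β(t)^*` of `K`. -/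
noncomputable def kernelK {p : ℕ} (β : ℝ → Matrix (Fin p) (Fin p ⊕ Fin p) ℂ) (x t : ℝ) :
    Matrix (Fin p) (Fin p) ℂ :=
  Complex.I • (β x * jMat p * (β t)ᴴ)

/-- The kernel `(t - x) I_p` of `A`. -/
noncomputable def kernelA (p : ℕ) (x t : ℝ) : Matrix (Fin p) (Fin p) ℂ :=
  ((t - x : ℝ) : ℂ) • (1 : Matrix (Fin p) (Fin p) ℂ)

theorem isBddKernel_kernelK {p : ℕ} {T : ℝ} {β : ℝ → Matrix (Fin p) (Fin p ⊕ Fin p) ℂ}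
    (hβ : ContinuousOn β (Icc (0 : ℝ) T)) : IsBddKernel T (kernelK β) := by
  apply IsBddKernel.of_continuousOn
  have hb : ∀ a c, ContinuousOn (fun x => β x a c) (Icc (0 : ℝ) T) := fun a c =>
    continuousOn_pi.1 (continuousOn_pi.1 hβ a) c
  have h1 : ∀ a c, ContinuousOn (fun z : ℝ × ℝ => β z.1 a c) (triangle T) := fun a c =>
    (hb a c).comp continuous_fst.continuousOn fun z hz => ⟨hz.1.trans hz.2.1, hz.2.2⟩
  have h2 : ∀ a c, ContinuousOn (fun z : ℝ × ℝ => β z.2 a c) (triangle T) := fun a c =>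
    (hb a c).comp continuous_snd.continuousOn fun z hz => ⟨hz.1, hz.2.1.trans hz.2.2⟩
  refine continuousOn_pi.2 fun a => continuousOn_pi.2 fun b => ?_
  simp only [kernelK, Matrix.smul_apply, Matrix.mul_apply, Matrix.conjTranspose_apply, smul_eq_mul]
  refine continuousOn_const.mul (continuousOn_finsetSum _ fun c _ => ContinuousOn.mul
    (continuousOn_finsetSum _ fun d _ => (h1 a d).mul continuousOn_const) ?_)
  exact continuous_star.comp_continuousOn (h2 b c)

theorem isBddKernel_kernelA (p : ℕ) (T : ℝ) : IsBddKernel T (kernelA p) := by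
  apply IsBddKernel.of_continuousOn
  apply Continuous.continuousOn
  unfold kernelA
  fun_prop

/-- The operator `K = i β(x) j ∫_0^x β(t)^* · dt` on `L_2^p(0,T)`. -/
noncomputable def opK {p : ℕ} (T : ℝ) (β : ℝ → Matrix (Fin p) (Fin p ⊕ Fin p) ℂ)
    (hβ : ContinuousOn β (Icc (0 : ℝ) T)) : L2vec p T →L[ℂ] L2vec p T :=
  volterraOp T (kernelK β) (isBddKernel_kernelK hβ)

/-- The operator `A f = ∫_0^x (t - x) f(t) dt` on `L_2^p(0,T)`. -/
noncomputable def opA (p : ℕ) (T : ℝ) : L2vec p T →L[ℂ] L2vec p T :=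
  volterraOp T (kernelA p) (isBddKernel_kernelA p T)

/-! Write H = β'jβ'^* and X = β''jβ'^*. Differentiating β'jβ^* = i I gives β''jβ^* = -H, and the
rows of β' and β together form a basis, so almost everywhere β'' = iHβ' + (iX + H²)β. For fixed t,
the kernel y(x) = iβ(x)jβ(t)^* of K therefore solves a linear second order equation with y(t) = 0,
y'(t) = -I. The unitary gauge u' = (i/2)Hu removes the first order term: z = u^*y satisfies z'' = qz
with q = u^*((i/2)(X - X^*) + (3/4)H²)u in L². Integrated twice, the gauged kernel k(x,t) =
u(x)^*K(x,t)u(t) obeys k = A + Qk, where Q has kernel (x-s)q(s) (`exists_gauged_kernel`).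

It remains to find a Volterra operator W with bounded kernel and k(I+W) = (I+W)A. Formally W(x,t)
solves W_xx - W_tt = qW, together with a source q on the diagonal. Since q is only in L², the
equation is not used in differentiated form. W is built as a sum of retarded potentials by a fixed
point argument on the sector |t| ≤ x, where free-space potentials need no boundary condition at t =
0 (`exists_sector_integral_equation`). A moment identity for a single point source
(`integral_coneIndicator_sub`), integrated over all sources, turns this into WA = AW + Q(I+W)A
(`exists_transmutation_kernel`).

Consequently (I+W)A and k(I+W) are both solutions R of R = A(I+W) + QR, and such a solution is
unique because Q is a Volterra operator (`exists_intertwining_kernel`). Finally I+W is invertible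
because the powers of W decay factorially, and V = u(I+W) gives KV = u k(I+W) = u(I+W)A = VA. -/

/-! ### Exponential weights for Volterra equations with L² coefficients -/

/-- A single weight that makes integration against g a 1/2-contraction in the norm sup |v(x)|
e^{-lx}. It replaces a smallness assumption on T or g in each fixed point and uniqueness argument
for the integral equations below. -/
theorem exists_exp_weight {T : ℝ} {g : ℝ → ℝ} (hg : IntegrableOn g (Ioo 0 T))
    (hg2 : IntegrableOn (fun s => g s ^ 2) (Ioo 0 T)) :
    ∃ l : ℝ, 0 ≤ l ∧ ∀ x ∈ Icc (0 : ℝ) T,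
      ∫ s in Ioo 0 x, g s * Real.exp (l * s) ≤ 1 / 2 * Real.exp (l * x) := by
  set S := ∫ s in Ioo 0 T, g s ^ 2 with hS
  have hS0 : 0 ≤ S := integral_nonneg fun s => sq_nonneg _
  -- The Young parameter e is 1/l. With these values the g² term and the exponential term below each
  -- contribute at most 1/4.
  set e : ℝ := 1 / (2 * (S + 1)) with he
  set l : ℝ := 2 * (S + 1) with hl
  have hl0 : 0 < l := by positivity
  have he0 : 0 < e := by positivity
  refine ⟨l, hl0.le, fun x hx => ?_⟩
  have hsub : Ioo 0 x ⊆ Ioo 0 T := Ioo_subset_Ioo_right hx.2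
  have hcont : IntegrableOn (fun s => Real.exp (2 * l * s - l * x)) (Ioo 0 x) :=
    ((by fun_prop : Continuous fun s => Real.exp (2 * l * s - l * x)).continuousOn.integrableOn_Icc
      (a := 0) (b := x)).mono_set Ioo_subset_Icc_self
  have hsq : IntegrableOn (fun s => e / 2 * Real.exp (l * x) * g s ^ 2) (Ioo 0 x) :=
    (hg2.mono_set hsub).const_mul _
  -- Young's inequality, with e^{ls} split as e^{lx/2} e^{ls - lx/2}; the difference of the two
  -- sides is a perfect square.
  have hpt : ∀ s, g s * Real.exp (l * s) ≤
      e / 2 * Real.exp (l * x) * g s ^ 2 + 1 / (2 * e) * Real.exp (2 * l * s - l * x) := by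
    intro s
    set a := Real.exp (l * x / 2) with ha
    set b := Real.exp (l * s - l * x / 2) with hb
    have h1 : Real.exp (l * s) = a * b := by rw [ha, hb, ← Real.exp_add]; ring_nf
    have h2 : Real.exp (l * x) = a ^ 2 := by rw [ha, ← Real.exp_nat_mul]; ring_nf
    have h3 : Real.exp (2 * l * s - l * x) = b ^ 2 := by rw [hb, ← Real.exp_nat_mul]; ring_nf
    rw [h1, h2, h3]
    have h4 : e / 2 * a ^ 2 * g s ^ 2 + 1 / (2 * e) * b ^ 2 - g s * (a * b) =
        1 / (2 * e) * (e * (g s * a) - b) ^ 2 := by field_simp; ring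
    have h5 : 0 ≤ 1 / (2 * e) * (e * (g s * a) - b) ^ 2 := by positivity
    linarith
  have hexp : ∫ s in Ioo 0 x, Real.exp (2 * l * s - l * x) ≤ 1 / (2 * l) * Real.exp (l * x) := by
    rw [← integral_Ioc_eq_integral_Ioo, ← intervalIntegral.integral_of_le hx.1,
      intervalIntegral.integral_eq_sub_of_hasDerivAt
        (f := fun s => 1 / (2 * l) * Real.exp (2 * l * s - l * x))]
    · have h6 : 2 * l * x - l * x = l * x := by ring
      have h7 := Real.exp_pos (2 * l * 0 - l * x)
      have h8 : 0 ≤ 1 / (2 * l) * Real.exp (2 * l * 0 - l * x) := by positivity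
      rw [h6]
      linarith
    · intro s _
      have h9 := ((((hasDerivAt_id s).const_mul (2 * l)).sub_const (l * x)).exp).const_mul
        (1 / (2 * l))
      refine h9.congr_deriv ?_
      simp only [id]
      field_simp
    · exact (by fun_prop : Continuous fun s => Real.exp (2 * l * s - l * x)).intervalIntegrable _ _
  have hgi : IntegrableOn (fun s => g s * Real.exp (l * s)) (Ioo 0 x) := by
    rw [← integrableOn_Icc_iff_integrableOn_Ioo]
    refine IntegrableOn.mul_continuousOn ?_ (by fun_prop) isCompact_Icc
    rw [integrableOn_Icc_iff_integrableOn_Ioo]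
    exact hg.mono_set hsub
  have hadd : IntegrableOn (fun s => e / 2 * Real.exp (l * x) * g s ^ 2 +
      1 / (2 * e) * Real.exp (2 * l * s - l * x)) (Ioo 0 x) := hsq.add (hcont.const_mul _)
  calc ∫ s in Ioo 0 x, g s * Real.exp (l * s)
      ≤ ∫ s in Ioo 0 x, (e / 2 * Real.exp (l * x) * g s ^ 2 +
          1 / (2 * e) * Real.exp (2 * l * s - l * x)) :=
        integral_mono hgi hadd hpt
    _ = e / 2 * Real.exp (l * x) * (∫ s in Ioo 0 x, g s ^ 2) +
          1 / (2 * e) * ∫ s in Ioo 0 x, Real.exp (2 * l * s - l * x) := by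
        rw [integral_add hsq (hcont.const_mul _), integral_const_mul, integral_const_mul]
    _ ≤ e / 2 * Real.exp (l * x) * S + 1 / (2 * e) * (1 / (2 * l) * Real.exp (l * x)) := by
        have h10 : ∫ s in Ioo 0 x, g s ^ 2 ≤ S :=
          setIntegral_mono_set hg2 (ae_of_all _ fun s => sq_nonneg _) hsub.eventuallyLE
        gcongr
    _ ≤ 1 / 2 * Real.exp (l * x) := by
        have h11 : e / 2 * S + 1 / (2 * e) * (1 / (2 * l)) ≤ 1 / 2 := by
          have h12 : e / 2 * S ≤ 1 / 4 := by
            rw [he, div_div, one_div_mul_eq_div, div_le_div_iff₀ (by positivity) (by norm_num)]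
            linarith
          have h13 : 1 / (2 * e) * (1 / (2 * l)) = 1 / 4 := by
            rw [he, hl]; field_simp; norm_num
          linarith
        have h14 := mul_le_mul_of_nonneg_right h11 (Real.exp_pos (l * x)).le
        linarith

/-- Bielecki's device: in the norm weighted by e^{-lτ} the map is a contraction, so Banach's theorem
applies without iterating or subdividing the interval. -/
theorem exists_fixedPoint_of_weight {X E : Type*} [TopologicalSpace X] [CompactSpace X]
    [NormedAddCommGroup E] [NormedSpace ℝ E] [CompleteSpace E] (τ : C(X, ℝ)) (l : ℝ)
    (Φ : C(X, E) → C(X, E))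
    (hΦ : ∀ v w : C(X, E), ∀ m : ℝ, 0 ≤ m → (∀ z, ‖v z - w z‖ ≤ m * Real.exp (l * τ z)) →
      ∀ z, ‖Φ v z - Φ w z‖ ≤ m / 2 * Real.exp (l * τ z)) :
    ∃ v, Φ v = v := by
  let a : C(X, ℝ) := ⟨fun z => Real.exp (l * τ z), by fun_prop⟩
  let b : C(X, ℝ) := ⟨fun z => Real.exp (-(l * τ z)), by fun_prop⟩
  have hab : ∀ (w : C(X, E)), a • b • w = w := by
    intro w
    ext z
    simp [a, b, smul_smul, ← Real.exp_add]
  -- Conjugating by the weight turns the weighted estimate into a contraction for the usual sup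
  -- norm, which is already complete.
  let Ψ : C(X, E) → C(X, E) := fun v => b • Φ (a • v)
  have hc : ContractingWith (1 / 2) Ψ := by
    refine ⟨by norm_num [← NNReal.coe_lt_coe], LipschitzWith.of_dist_le_mul fun v w => ?_⟩
    rw [ContinuousMap.dist_le (by positivity)]
    intro z
    have h := hΦ (a • v) (a • w) (dist v w) dist_nonneg (fun y => by
      have h1 := ContinuousMap.dist_apply_le_dist (f := v) (g := w) y
      rw [dist_eq_norm] at h1
      simp only [ContinuousMap.smul_apply', a, ContinuousMap.coe_mk]
      rw [← smul_sub, norm_smul, Real.norm_of_nonneg (Real.exp_pos _).le, mul_comm]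
      gcongr) z
    simp only [Ψ, ContinuousMap.smul_apply', b, ContinuousMap.coe_mk, dist_eq_norm]
    rw [← smul_sub, norm_smul, Real.norm_of_nonneg (Real.exp_pos _).le]
    calc Real.exp (-(l * τ z)) * ‖Φ (a • v) z - Φ (a • w) z‖
        ≤ Real.exp (-(l * τ z)) * (dist v w / 2 * Real.exp (l * τ z)) := by gcongr
      _ = dist v w / 2 * (Real.exp (-(l * τ z)) * Real.exp (l * τ z)) := by ring
      _ = ((1 / 2 : NNReal) : ℝ) * dist v w := by
        rw [← Real.exp_add]; simp; ring
      _ = ((1 / 2 : NNReal) : ℝ) * ‖v - w‖ := by rw [dist_eq_norm]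
  have : Nonempty C(X, E) := ⟨0⟩
  refine ⟨a • hc.fixedPoint, ?_⟩
  have h := hc.fixedPoint_isFixedPt
  calc Φ (a • hc.fixedPoint) = a • Ψ hc.fixedPoint := (hab _).symm
    _ = _ := by rw [h]

/-- The uniqueness counterpart: the weighted bound can be halved indefinitely. No continuity of d is
required. -/
theorem eq_zero_of_weight {X F : Type*} [NormedAddCommGroup F] {d : X → F} {τ : X → ℝ}
    {l C : ℝ} (hC0 : 0 ≤ C) (hC : ∀ x, ‖d x‖ ≤ C * Real.exp (l * τ x))
    (hd : ∀ m : ℝ, 0 ≤ m → (∀ x, ‖d x‖ ≤ m * Real.exp (l * τ x)) →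
      ∀ x, ‖d x‖ ≤ m / 2 * Real.exp (l * τ x)) (x : X) : d x = 0 := by
  have h : ∀ n : ℕ, ∀ x, ‖d x‖ ≤ C * (1 / 2) ^ n * Real.exp (l * τ x) := by
    intro n
    induction n with
    | zero => simpa using hC
    | succ n ih =>
      intro x
      have := hd _ (by positivity) ih x
      rw [pow_succ]
      linarith
  have hlim : Filter.Tendsto (fun n : ℕ => C * (1 / 2 : ℝ) ^ n * Real.exp (l * τ x)) Filter.atTop
      (nhds (C * 0 * Real.exp (l * τ x))) :=
    ((tendsto_pow_atTop_nhds_zero_of_lt_one (by norm_num) (by norm_num)).const_mul C).mul_const _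
  have h1 := ge_of_tendsto' hlim fun n => h n x
  simpa using h1

/-! ### Light cones and the moment identity for one point source -/

/-- The indicator function of the cone `|y| ≤ h`. -/
noncomputable def coneIndicator (h y : ℝ) : ℝ := if |y| ≤ h then 1 else 0

theorem measurable_coneIndicator : Measurable fun z : ℝ × ℝ => coneIndicator z.1 z.2 :=
  Measurable.ite (isClosed_le (by fun_prop) (by fun_prop)).measurableSet measurable_const
    measurable_const

theorem norm_coneIndicator_le_one (h y : ℝ) : ‖coneIndicator h y‖ ≤ 1 := by
  unfold coneIndicator; split_ifs <;> norm_num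

theorem coneIndicator_of_le {h y : ℝ} (hy : |y| ≤ h) : coneIndicator h y = 1 := if_pos hy

theorem coneIndicator_of_lt {h y : ℝ} (hy : h < |y|) : coneIndicator h y = 0 := if_neg hy.not_ge

theorem continuousAt_coneIndicator {h y : ℝ} (hy : |y| ≠ h) :
    ContinuousAt (fun z : ℝ × ℝ => coneIndicator z.1 z.2) (h, y) := by
  rcases lt_or_gt_of_ne hy with h1 | h1
  · have h2 : ∀ᶠ z : ℝ × ℝ in nhds (h, y), |z.2| < z.1 :=
      (isOpen_lt (by fun_prop) (by fun_prop)).mem_nhds h1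
    refine continuousAt_const (y := (1 : ℝ)) |>.congr ?_
    filter_upwards [h2] with z hz
    exact (coneIndicator_of_le hz.le).symm
  · have h2 : ∀ᶠ z : ℝ × ℝ in nhds (h, y), z.1 < |z.2| :=
      (isOpen_lt (by fun_prop) (by fun_prop)).mem_nhds h1
    refine continuousAt_const (y := (0 : ℝ)) |>.congr ?_
    filter_upwards [h2] with z hz
    exact (coneIndicator_of_lt hz).symm

theorem intervalIntegral_indicator_Icc {E : Type*} [NormedAddCommGroup E] [NormedSpace ℝ E]
    {t x : ℝ} (htx : t ≤ x) (a b : ℝ) (f : ℝ → E) :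
    ∫ v in t..x, (Icc a b).indicator f v = ∫ v in Icc (max a t) (min b x), f v := by
  rw [intervalIntegral.integral_of_le htx, ← integral_Icc_eq_integral_Ioc,
    integral_indicator measurableSet_Icc, Measure.restrict_restrict measurableSet_Icc,
    Icc_inter_Icc]

theorem integral_Icc_sub_const {c d : ℝ} (hcd : c ≤ d) (t : ℝ) :
    ∫ v in Icc c d, (v - t) = ((d - t) ^ 2 - (c - t) ^ 2) / 2 := by
  rw [integral_Icc_eq_integral_Ioc, ← intervalIntegral.integral_of_le hcd,
    intervalIntegral.integral_comp_sub_right (fun v => v), integral_id]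

/-- This is the wave equation for the fundamental solution, integrated twice in each variable: the
left side inverts ∂_x² and ∂_t² on the cone indicator, and the right side is the response to a unit
mass at (s,r). Both integrals on the left are elementary once the cone is written as an interval of
integration; the cases record which end points are active. -/
theorem integral_coneIndicator_sub {s r t x : ℝ} (hr : |r| ≤ s) (htx : t ≤ x) :
    (∫ v in t..x, (v - t) * coneIndicator (x - s) (r - v)) -
      ∫ y in t..x, (x - y) * coneIndicator (y - s) (r - t) =
      2 * (max (x - s) 0 * max (r - t) 0) := by
  have e1 : ∫ v in t..x, (v - t) * coneIndicator (x - s) (r - v) =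
      ∫ v in Icc (max (r - (x - s)) t) (min (r + (x - s)) x), (v - t) := by
    rw [← intervalIntegral_indicator_Icc htx]
    refine intervalIntegral.integral_congr fun v _ => ?_
    simp only [coneIndicator, indicator, mem_Icc, abs_le]
    by_cases hv : r - (x - s) ≤ v ∧ v ≤ r + (x - s)
    · rw [if_pos hv, if_pos ⟨by linarith, by linarith⟩, mul_one]
    · rw [if_neg hv, if_neg, mul_zero]
      exact fun h => hv ⟨by linarith, by linarith⟩
  have e2 : ∫ y in t..x, (x - y) * coneIndicator (y - s) (r - t) =
      ∫ y in Icc (max (s + |r - t|) t) (min x x), (x - y) := by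
    rw [← intervalIntegral_indicator_Icc htx]
    refine intervalIntegral.integral_congr fun y hy => ?_
    rw [uIcc_of_le htx] at hy
    simp only [coneIndicator, indicator, mem_Icc]
    by_cases hv : s + |r - t| ≤ y ∧ y ≤ x
    · rw [if_pos hv, if_pos (by linarith), mul_one]
    · rw [if_neg hv, if_neg, mul_zero]
      exact fun h => hv ⟨by linarith, hy.2⟩
  have hs : t ≤ s + |r - t| := by
    linarith [le_abs_self r, neg_le_abs (r - t)]
  have hrs : r ≤ s := (le_abs_self r).trans hr
  -- Here r ≤ s is decisive: it makes r + (x - s) ≤ x and t ≤ s + |r - t|, so the intervals are not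
  -- clipped at these ends.
  rw [e1, e2, min_self, max_eq_left hs, min_eq_left (by linarith)]
  have e3 : ∀ c, c ≤ x → ∫ y in Icc c x, (x - y) = (x - c) ^ 2 / 2 := by
    intro c hc
    have : ∫ y in Icc c x, (x - y) = - ∫ y in Icc c x, (y - x) := by
      rw [← integral_neg]; simp
    rw [this, integral_Icc_sub_const hc]; ring
  have e4 : ∀ c (f : ℝ → ℝ), x < c → ∫ y in Icc c x, f y = 0 := by
    intro c f hc
    rw [Icc_eq_empty hc.not_ge, setIntegral_empty]
  rcases lt_or_ge (x - s) 0 with h0 | h0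
  · rw [max_eq_right h0.le, e4 _ _ (by linarith [abs_nonneg (r - t)]), Icc_eq_empty,
      setIntegral_empty]
    · ring
    · intro h; have := (le_max_left _ _).trans h; linarith
  · rw [max_eq_left h0]
    rcases le_or_gt t r with h1 | h1
    · rw [max_eq_left (by linarith : 0 ≤ r - t), abs_of_nonneg (by linarith),
        integral_Icc_sub_const (max_le (by linarith) (by linarith))]
      rcases le_or_gt (x - s) (r - t) with h2 | h2
      · rw [max_eq_left (by linarith)]
        rcases eq_or_lt_of_le h2 with h3 | h3
        · rw [e3 _ (by linarith), show x = s + (r - t) by linarith]; ring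
        · rw [e4 _ _ (by linarith)]; ring
      · rw [max_eq_right (by linarith), e3 _ (by linarith)]; ring
    · rw [max_eq_right (by linarith : r - t ≤ 0), abs_of_neg (by linarith),
        max_eq_right (by linarith)]
      rcases le_or_gt t (r + (x - s)) with h2 | h2
      · rw [integral_Icc_sub_const h2, e3 _ (by linarith)]; ring
      · rw [Icc_eq_empty h2.not_ge, setIntegral_empty, e4 _ _ (by linarith)]; ring

/-! ### Retarded potentials of the one-dimensional wave operator -/

section
variable {Ω E : Type*} [MeasurableSpace Ω] [NormedAddCommGroup E] [NormedSpace ℝ E]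
  {μ : Measure Ω} {σ ρ : Ω → ℝ} {Y : Ω → E}

/-- The retarded potential at `(x,t)` of the wave operator `∂_x² - ∂_t²`, for the sources `Y ω`
placed at the points `(σ ω, ρ ω)`. -/
noncomputable def wavePotential (μ : Measure Ω) (σ ρ : Ω → ℝ) (Y : Ω → E) (x t : ℝ) : E :=
  (1 / 2 : ℝ) • ∫ ω, coneIndicator (x - σ ω) (ρ ω - t) • Y ω ∂μ

theorem aestronglyMeasurable_coneIndicator_smul (hσ : Measurable σ) (hρ : Measurable ρ)
    (hY : AEStronglyMeasurable Y μ) (x t : ℝ) :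
    AEStronglyMeasurable (fun ω => coneIndicator (x - σ ω) (ρ ω - t) • Y ω) μ :=
  (measurable_coneIndicator.comp ((measurable_const.sub hσ).prodMk
    (hρ.sub measurable_const))).aestronglyMeasurable.smul hY

theorem norm_coneIndicator_smul_le (h y : ℝ) (v : E) : ‖coneIndicator h y • v‖ ≤ ‖v‖ := by
  rw [norm_smul]
  exact mul_le_of_le_one_left (norm_nonneg _) (norm_coneIndicator_le_one _ _)

theorem integrable_coneIndicator_smul (hσ : Measurable σ) (hρ : Measurable ρ)
    (hY : Integrable Y μ) (x t : ℝ) :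
    Integrable (fun ω => coneIndicator (x - σ ω) (ρ ω - t) • Y ω) μ :=
  hY.mono (aestronglyMeasurable_coneIndicator_smul hσ hρ hY.1 x t)
    (ae_of_all _ fun _ => norm_coneIndicator_smul_le _ _ _)

theorem norm_wavePotential_le (hY : Integrable Y μ) (x t : ℝ) :
    ‖wavePotential μ σ ρ Y x t‖ ≤ ∫ ω, ‖Y ω‖ ∂μ := by
  rw [wavePotential, norm_smul]
  have h1 := norm_integral_le_of_norm_le hY.norm
    (ae_of_all μ fun ω => norm_coneIndicator_smul_le (x - σ ω) (ρ ω - t) (Y ω))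
  have h2 : ‖(1 / 2 : ℝ)‖ ≤ 1 := by norm_num
  calc _ ≤ 1 * ∫ ω, ‖Y ω‖ ∂μ := by gcongr
    _ = _ := one_mul _

theorem stronglyMeasurable_wavePotential [SFinite μ] (hσ : Measurable σ) (hρ : Measurable ρ)
    (hY : AEStronglyMeasurable Y μ) :
    StronglyMeasurable fun z : ℝ × ℝ => wavePotential μ σ ρ Y z.1 z.2 := by
  -- The source is replaced by a strongly measurable representative, so that the integrand is
  -- jointly strongly measurable in the point and the source.
  have h : (fun z : ℝ × ℝ => wavePotential μ σ ρ Y z.1 z.2) = fun z : ℝ × ℝ =>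
      (1 / 2 : ℝ) • ∫ ω, coneIndicator (z.1 - σ ω) (ρ ω - z.2) • hY.mk Y ω ∂μ := by
    ext z
    rw [wavePotential]
    congr 1
    refine integral_congr_ae ?_
    filter_upwards [hY.ae_eq_mk] with ω hω
    rw [hω]
  rw [h]
  refine StronglyMeasurable.const_smul (StronglyMeasurable.integral_prod_right ?_) _
  refine StronglyMeasurable.smul (Measurable.stronglyMeasurable ?_)
    (hY.stronglyMeasurable_mk.comp_measurable measurable_snd)
  exact measurable_coneIndicator.comp (((measurable_fst.comp measurable_fst).sub
    (hσ.comp measurable_snd)).prodMk ((hρ.comp measurable_snd).sub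
    (measurable_snd.comp measurable_fst)))

/-- Moving the point changes the cone indicator only for sources near the boundary of the cone. If
each such boundary is null for the source measure, dominated convergence gives continuity. -/
theorem continuous_wavePotential (hσ : Measurable σ) (hρ : Measurable ρ) (hY : Integrable Y μ)
    (hμ : ∀ x t, ∀ᵐ ω ∂μ, |ρ ω - t| ≠ x - σ ω) :
    Continuous fun z : ℝ × ℝ => wavePotential μ σ ρ Y z.1 z.2 := by
  refine Continuous.const_smul ?_ _
  rw [continuous_iff_continuousAt]
  intro z
  refine continuousAt_of_dominated (bound := fun ω => ‖Y ω‖)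
    (Filter.Eventually.of_forall fun z =>
      aestronglyMeasurable_coneIndicator_smul hσ hρ hY.1 z.1 z.2)
    (Filter.Eventually.of_forall fun z => ae_of_all _ fun ω => norm_coneIndicator_smul_le _ _ _)
    hY.norm ?_
  filter_upwards [hμ z.1 z.2] with ω hω
  refine ContinuousAt.smul ?_ continuousAt_const
  exact ContinuousAt.comp (f := fun z : ℝ × ℝ => (z.1 - σ ω, ρ ω - z.2)) (x := z)
    (continuousAt_coneIndicator hω) (by fun_prop)

/-- Fubini moves the integration over the point onto the sources, which reduces identities for
potentials to a single point source. -/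
theorem integral_smul_wavePotential [CompleteSpace E] [SFinite μ]
    (hσ : Measurable σ) (hρ : Measurable ρ)
    (hY : Integrable Y μ) {t x : ℝ} (htx : t ≤ x) {φ a b : ℝ → ℝ} (hφ : Continuous φ)
    (ha : Measurable a) (hb : Measurable b) :
    ∫ v in t..x, φ v • wavePotential μ σ ρ Y (a v) (b v) =
      (1 / 2 : ℝ) • ∫ ω, (∫ v in t..x, φ v * coneIndicator (a v - σ ω) (ρ ω - b v)) • Y ω ∂μ := by
  simp only [intervalIntegral.integral_of_le htx]
  have h1 : ∀ v, φ v • wavePotential μ σ ρ Y (a v) (b v) =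
      (1 / 2 : ℝ) • ∫ ω, (φ v * coneIndicator (a v - σ ω) (ρ ω - b v)) • Y ω ∂μ := by
    intro v
    rw [wavePotential, smul_comm, ← integral_smul]
    simp only [mul_smul]
  simp only [h1]
  rw [integral_smul, integral_integral_swap]
  · congr 1
    refine integral_congr_ae (ae_of_all _ fun ω => ?_)
    exact integral_smul_const _ _
  · have hφi : Integrable φ (volume.restrict (Ioc t x)) :=
      (hφ.integrableOn_Icc).mono_set Ioc_subset_Icc_self
    have hprod : Integrable (fun z : ℝ × Ω => φ z.1 • Y z.2)
        ((volume.restrict (Ioc t x)).prod μ) := hφi.smul_prod hY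
    have hm : Measurable fun z : ℝ × Ω => coneIndicator (a z.1 - σ z.2) (ρ z.2 - b z.1) :=
      measurable_coneIndicator.comp (((ha.comp measurable_fst).sub
        (hσ.comp measurable_snd)).prodMk ((hρ.comp measurable_snd).sub (hb.comp measurable_fst)))
    have h2 : Integrable (fun z : ℝ × Ω =>
        coneIndicator (a z.1 - σ z.2) (ρ z.2 - b z.1) • φ z.1 • Y z.2)
        ((volume.restrict (Ioc t x)).prod μ) :=
      Integrable.mono hprod (AEStronglyMeasurable.fun_smul hm.aestronglyMeasurable hprod.1)
        (ae_of_all _ fun z => norm_coneIndicator_smul_le _ _ _)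
    refine h2.congr (ae_of_all _ fun z => ?_)
    simp only [Function.uncurry, smul_smul, mul_comm]

/-- The point source identity integrated against Y dμ. It is a weak form of the wave equation in
which nothing is differentiated, so it serves equally for sources on the diagonal and sources spread
over the sector. -/
theorem wavePotential_moment_identity [CompleteSpace E] [SFinite μ]
    (hσ : Measurable σ) (hρ : Measurable ρ)
    (hY : Integrable Y μ) (hρσ : ∀ᵐ ω ∂μ, |ρ ω| ≤ σ ω) {t x : ℝ} (htx : t ≤ x) :
    (∫ v in t..x, (v - t) • wavePotential μ σ ρ Y x v) -
      ∫ y in t..x, (x - y) • wavePotential μ σ ρ Y y t =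
      ∫ ω, (max (x - σ ω) 0 * max (ρ ω - t) 0) • Y ω ∂μ := by
  have key : ∀ {φ a b : ℝ → ℝ}, Continuous φ → Measurable a → Measurable b →
      Integrable (fun ω =>
        (∫ v in t..x, φ v * coneIndicator (a v - σ ω) (ρ ω - b v)) • Y ω) μ := by
    intro φ a b hφ ha hb
    have hm : StronglyMeasurable fun ω =>
        ∫ v in t..x, φ v * coneIndicator (a v - σ ω) (ρ ω - b v) := by
      simp only [intervalIntegral.integral_of_le htx]
      refine StronglyMeasurable.integral_prod_right (Measurable.stronglyMeasurable ?_)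
      exact (hφ.measurable.comp measurable_snd).mul (measurable_coneIndicator.comp
        (((ha.comp measurable_snd).sub (hσ.comp measurable_fst)).prodMk
          ((hρ.comp measurable_fst).sub (hb.comp measurable_snd))))
    refine (hY.norm.const_mul (∫ v in t..x, ‖φ v‖)).mono' (hm.aestronglyMeasurable.smul hY.1)
      (ae_of_all _ fun ω => ?_)
    rw [norm_smul]
    gcongr
    refine intervalIntegral.norm_integral_le_of_norm_le htx (ae_of_all _ fun v _ => ?_)
      (hφ.norm.intervalIntegrable _ _)
    rw [norm_mul]
    exact mul_le_of_le_one_right (norm_nonneg _) (norm_coneIndicator_le_one _ _)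
  rw [integral_smul_wavePotential hσ hρ hY htx (φ := fun v => v - t) (a := fun _ => x)
      (b := fun v => v) (by fun_prop) measurable_const measurable_id,
    integral_smul_wavePotential hσ hρ hY htx (φ := fun y => x - y) (a := fun y => y)
      (b := fun _ => t) (by fun_prop) measurable_id measurable_const, ← smul_sub,
    ← integral_sub (key (φ := fun v => v - t) (a := fun _ => x) (b := fun v => v) (by fun_prop)
      measurable_const measurable_id) (key (φ := fun y => x - y) (a := fun y => y)
      (b := fun _ => t) (by fun_prop) measurable_id measurable_const), ← integral_smul]
  refine integral_congr_ae ?_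
  filter_upwards [hρσ] with ω hω
  rw [← sub_smul, integral_coneIndicator_sub hω htx, smul_smul]
  congr 1
  ring

end

/-! ### The integral equation for the transmutation kernel -/

/-- The sector `0 < s < T`, `|r| ≤ s` in the plane of points `(s,r)`. -/
def sector (T : ℝ) : Set (ℝ × ℝ) := {z | 0 < z.1 ∧ z.1 < T ∧ |z.2| ≤ z.1}

theorem measurableSet_sector (T : ℝ) : MeasurableSet (sector T) :=
  (isOpen_lt continuous_const continuous_fst).measurableSet.inter
    ((isOpen_lt continuous_fst continuous_const).measurableSet.inter
      (isClosed_le (by fun_prop) continuous_fst).measurableSet)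

theorem sector_subset (T : ℝ) : sector T ⊆ Ioo 0 T ×ˢ Icc (-T) T := fun _ hz =>
  ⟨⟨hz.1, hz.2.1⟩, abs_le.1 (hz.2.2.trans hz.2.1.le)⟩

theorem volume_restrict_sector_le (T : ℝ) : (volume : Measure (ℝ × ℝ)).restrict (sector T) ≤
    (volume.restrict (Ioo 0 T)).prod (volume.restrict (Icc (-T) T)) := by
  rw [Measure.prod_restrict, ← Measure.volume_eq_prod]
  exact Measure.restrict_mono (sector_subset T) le_rfl

/-- Each line s = const meets the cone boundary in at most two points. -/
theorem ae_abs_sub_ne (T x t : ℝ) :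
    ∀ᵐ z ∂(volume : Measure (ℝ × ℝ)).restrict (sector T), |z.2 - t| ≠ x - z.1 := by
  refine ae_restrict_of_ae ?_
  have hm : MeasurableSet {z : ℝ × ℝ | |z.2 - t| = x - z.1} :=
    (isClosed_eq (by fun_prop) (by fun_prop)).measurableSet
  have h : volume {z : ℝ × ℝ | |z.2 - t| = x - z.1} = 0 := by
    rw [Measure.volume_eq_prod, Measure.measure_prod_null hm]
    refine Filter.Eventually.of_forall fun s => ?_
    refine measure_mono_null (t := {t + (x - s), t - (x - s)}) ?_
      ((Set.toFinite _).measure_zero _)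
    intro r hr
    have hr' : |r - t| = x - s := hr
    simp only [mem_insert_iff, mem_singleton_iff]
    rcases abs_choice (r - t) with h | h
    · left; linarith
    · right; linarith
  filter_upwards [measure_eq_zero_iff_ae_notMem.1 h] with z hz using hz

section
variable {E : Type*} [NormedRing E] {T : ℝ} {q : ℝ → E}

theorem integrable_fst_mul_sector (hq : IntegrableOn q (Ioo 0 T)) {w : ℝ × ℝ → E}
    (hw : AEStronglyMeasurable w (volume.restrict (sector T))) {C : ℝ} (hC : ∀ z, ‖w z‖ ≤ C) :
    Integrable (fun z : ℝ × ℝ => q z.1 * w z) (volume.restrict (sector T)) := by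
  have h : Integrable (fun z : ℝ × ℝ => q z.1) (volume.restrict (sector T)) :=
    (hq.comp_fst (volume.restrict (Icc (-T) T))).mono_measure (volume_restrict_sector_le T)
  refine (h.norm.mul_const C).mono' (h.1.mul hw) (ae_of_all _ fun z => ?_)
  exact (norm_mul_le _ _).trans (by gcongr; exact hC z)

variable [NormedAlgebra ℝ E]

/-- Only sources with s < x matter. Enlarging the cone to the strip |r| ≤ T of width 2T, together
with the factor 1/2 of the potential, produces the factor T and reduces the bound to a
one-dimensional weighted integral. -/
theorem norm_wavePotential_sector_le (hT : 0 ≤ T) (hq : IntegrableOn q (Ioo 0 T)) {w : ℝ × ℝ → E}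
    {m l : ℝ} (hm : 0 ≤ m) (hw : ∀ z ∈ sector T, ‖w z‖ ≤ m * Real.exp (l * z.1))
    {x : ℝ} (hx : x ∈ Icc 0 T) (t : ℝ) :
    ‖wavePotential (volume.restrict (sector T)) Prod.fst Prod.snd
      (fun z => q z.1 * w z) x t‖ ≤ m * ∫ s in Ioo 0 x, T * ‖q s‖ * Real.exp (l * s) := by
  set g : ℝ → ℝ := (Ioo 0 x).indicator fun s => ‖q s‖ * Real.exp (l * s) with hg
  have hg0 : ∀ s, 0 ≤ g s := fun s => indicator_nonneg (fun s _ => by positivity) s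
  have hgi : Integrable g (volume.restrict (Ioo 0 T)) := by
    rw [hg, integrable_indicator_iff measurableSet_Ioo, IntegrableOn,
      Measure.restrict_restrict measurableSet_Ioo, ← IntegrableOn]
    have h1 : IntegrableOn (fun s => ‖q s‖ * Real.exp (l * s)) (Ioo 0 T) := by
      rw [← integrableOn_Icc_iff_integrableOn_Ioo]
      refine IntegrableOn.mul_continuousOn ?_ (by fun_prop) isCompact_Icc
      rw [integrableOn_Icc_iff_integrableOn_Ioo]
      exact hq.norm
    exact h1.mono_set inter_subset_right
  have hgp : Integrable (fun z : ℝ × ℝ => g z.1)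
      ((volume.restrict (Ioo 0 T)).prod (volume.restrict (Icc (-T) T))) := hgi.comp_fst _
  have hint : ∫ z, m * g z.1 ∂((volume.restrict (Ioo 0 T)).prod (volume.restrict (Icc (-T) T))) =
      2 * (m * ∫ s in Ioo 0 x, T * ‖q s‖ * Real.exp (l * s)) := by
    rw [integral_const_mul]
    have h2 := integral_prod_mul (μ := volume.restrict (Ioo 0 T))
      (ν := volume.restrict (Icc (-T) T)) g (fun _ => (1 : ℝ))
    simp only [mul_one] at h2
    have h3 : ∫ s in Ioo 0 T, g s = ∫ s in Ioo 0 x, ‖q s‖ * Real.exp (l * s) := by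
      rw [hg, integral_indicator measurableSet_Ioo, Measure.restrict_restrict measurableSet_Ioo,
        inter_eq_left.2 (Ioo_subset_Ioo_right hx.2)]
    have h4 : ∫ _ in Icc (-T) T, (1 : ℝ) = 2 * T := by
      rw [setIntegral_const, Measure.real, Real.volume_Icc,
        ENNReal.toReal_ofReal (by linarith), smul_eq_mul]
      ring
    rw [h2, h3, h4]
    simp only [mul_assoc]
    rw [integral_const_mul]
    ring
  rw [wavePotential, norm_smul, Real.norm_of_nonneg (by norm_num)]
  have hmain : ‖∫ z in sector T, coneIndicator (x - z.1) (z.2 - t) • (q z.1 * w z)‖ ≤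
      ∫ z in sector T, m * g z.1 := by
    refine norm_integral_le_of_norm_le
      ((hgp.mono_measure (volume_restrict_sector_le T)).const_mul m) ?_
    filter_upwards [ae_restrict_mem (measurableSet_sector T), ae_abs_sub_ne T x t] with z hz hne
    rcases lt_or_ge (x - z.1) |z.2 - t| with h | h
    · rw [coneIndicator_of_lt h, zero_smul, norm_zero]
      exact mul_nonneg hm (hg0 _)
    -- Off the null boundary of the cone, |r - t| < x - s, which forces s < x strictly.
    · have hzx : z.1 ∈ Ioo 0 x := by
        refine ⟨hz.1, ?_⟩
        have := lt_of_le_of_ne h hne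
        linarith [abs_nonneg (z.2 - t)]
      rw [coneIndicator_of_le h, one_smul, hg, indicator_of_mem hzx]
      calc ‖q z.1 * w z‖ ≤ ‖q z.1‖ * (m * Real.exp (l * z.1)) :=
            (norm_mul_le _ _).trans (by gcongr; exact hw z hz)
        _ = _ := by ring
  have hle : ∫ z in sector T, m * g z.1 ≤
      ∫ z, m * g z.1 ∂((volume.restrict (Ioo 0 T)).prod (volume.restrict (Icc (-T) T))) :=
    integral_mono_measure (volume_restrict_sector_le T)
      (ae_of_all _ fun z => mul_nonneg hm (hg0 _)) (hgp.const_mul m)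
  linarith

/-- The weighted fixed point theorem, with the weight in x alone. The first potential has its
sources on the diagonal; formally it carries the Goursat data W(x,x) = (1/2)∫_0^x q and W(x,-x) = 0.
-/
theorem exists_sector_integral_equation [CompleteSpace E] (hT : 0 ≤ T)
    (hq : IntegrableOn q (Ioo 0 T)) (hq2 : IntegrableOn (fun s => ‖q s‖ ^ 2) (Ioo 0 T)) :
    ∃ W : ℝ → ℝ → E, StronglyMeasurable (fun z : ℝ × ℝ => W z.1 z.2) ∧
      (∃ C, ∀ x t, ‖W x t‖ ≤ C) ∧
      ∀ x ∈ Icc 0 T, ∀ t ∈ Icc (-T) T, W x t =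
        wavePotential (volume.restrict (Ioo 0 T)) id id q x t +
        wavePotential (volume.restrict (sector T)) Prod.fst Prod.snd
          (fun z => q z.1 * W z.1 z.2) x t := by
  obtain ⟨l, -, hl⟩ := exists_exp_weight (g := fun s => T * ‖q s‖) (hq.norm.const_mul T)
    ((hq2.const_mul (T ^ 2)).congr (ae_of_all _ fun s => by ring))
  set W₀ : ℝ × ℝ → E := fun z =>
    wavePotential (volume.restrict (Ioo 0 T)) id id q z.1 z.2 with hW₀
  have hW₀m : StronglyMeasurable W₀ :=
    stronglyMeasurable_wavePotential measurable_id measurable_id hq.1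
  have hW₀b : ∀ z, ‖W₀ z‖ ≤ ∫ s in Ioo 0 T, ‖q s‖ := fun z => norm_wavePotential_le hq _ _
  let π : ℝ × ℝ → Icc (0 : ℝ) T × Icc (-T) T := fun z =>
    (projIcc 0 T hT z.1, projIcc (-T) T (by linarith) z.2)
  have hπ : Continuous π := by fun_prop
  -- The diagonal potential W₀ can jump across t = x, because the diagonal is itself a light ray.
  -- Hence the fixed point is sought for the continuous remainder W - W₀ only, extended to the plane
  -- by clamping its argument to the box.
  let ext : C(Icc (0 : ℝ) T × Icc (-T) T, E) → ℝ × ℝ → E := fun w z => W₀ z + w (π z)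
  have hext : ∀ w, StronglyMeasurable (ext w) := fun w =>
    hW₀m.add (w.continuous.comp hπ).stronglyMeasurable
  have hextb : ∀ w z, ‖ext w z‖ ≤ (∫ s in Ioo 0 T, ‖q s‖) + ‖w‖ := fun w z =>
    (norm_add_le _ _).trans (add_le_add (hW₀b z) (w.norm_coe_le_norm _))
  have hint : ∀ w, Integrable (fun z : ℝ × ℝ => q z.1 * ext w z) (volume.restrict (sector T)) :=
    fun w => integrable_fst_mul_sector hq (hext w).aestronglyMeasurable (hextb w)
  let pot : C(Icc (0 : ℝ) T × Icc (-T) T, E) → ℝ × ℝ → E := fun w z =>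
    wavePotential (volume.restrict (sector T)) Prod.fst Prod.snd
      (fun z => q z.1 * ext w z) z.1 z.2
  have hpot : ∀ w, Continuous (pot w) := fun w =>
    continuous_wavePotential measurable_fst measurable_snd (hint w) (ae_abs_sub_ne T)
  let Φ : C(Icc (0 : ℝ) T × Icc (-T) T, E) → C(Icc (0 : ℝ) T × Icc (-T) T, E) := fun w =>
    ⟨fun z => pot w (z.1, z.2), (hpot w).comp (by fun_prop)⟩
  obtain ⟨w, hw⟩ := exists_fixedPoint_of_weight
    (⟨fun z : Icc (0 : ℝ) T × Icc (-T) T => (z.1 : ℝ), by fun_prop⟩ :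
      C(Icc (0 : ℝ) T × Icc (-T) T, ℝ)) l Φ (by
    intro v w m hm hvw z
    have h1 : Φ v z - Φ w z = wavePotential (volume.restrict (sector T)) Prod.fst Prod.snd
        (fun z => q z.1 * (ext v z - ext w z)) z.1 z.2 := by
      simp only [Φ, pot, ContinuousMap.coe_mk, wavePotential]
      rw [← smul_sub, ← integral_sub
        (integrable_coneIndicator_smul measurable_fst measurable_snd (hint v) _ _)
        (integrable_coneIndicator_smul measurable_fst measurable_snd (hint w) _ _)]
      simp only [← smul_sub, ← mul_sub]
    rw [h1]
    refine (norm_wavePotential_sector_le hT hq (m := m) (l := l) hm ?_ z.1.2 _).trans ?_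
    · intro y hy
      have h2 := hvw (π y)
      have h3 : ((π y).1 : ℝ) = y.1 := by
        simp only [π]
        rw [projIcc_of_mem hT ⟨hy.1.le, hy.2.1.le⟩]
      simp only [ContinuousMap.coe_mk, h3] at h2
      simpa [ext] using h2
    · calc _ ≤ m * (1 / 2 * Real.exp (l * z.1)) := by gcongr; exact hl _ z.1.2
        _ = _ := by simp only [ContinuousMap.coe_mk]; ring)
  refine ⟨fun x t => W₀ (x, t) + pot w (x, t), hW₀m.add (hpot w).stronglyMeasurable,
    ⟨_, fun x t => (norm_add_le _ _).trans
      (add_le_add (hW₀b _) (norm_wavePotential_le (hint w) _ _))⟩, fun x _ t _ => ?_⟩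
  simp only [hW₀, pot]
  congr 1
  rw [wavePotential, wavePotential]
  congr 1
  -- On the sector the clamping does nothing, and the fixed point property identifies w with its
  -- potential.
  refine setIntegral_congr_fun (measurableSet_sector T) fun z hz => ?_
  have hz' := sector_subset T hz
  have h4 : π z = (⟨z.1, Ioo_subset_Icc_self hz'.1⟩, ⟨z.2, hz'.2⟩) := by
    simp only [π]
    rw [projIcc_of_mem hT (Ioo_subset_Icc_self hz'.1), projIcc_of_mem (by linarith) hz'.2]
  have h5 : w (π z) = pot w z := by
    rw [← DFunLike.congr_fun hw (π z), h4]
    rfl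
  simp only [ext, h5]
  rfl

/-- The moment identity applied to both potentials that make up W: the diagonal sources yield the
term with s - t, the sector sources the term with the inner integral. In operator form the
conclusion reads WA = AW + Q(I+W)A, with Q the kernel (x-s)q(s). -/
theorem exists_transmutation_kernel [CompleteSpace E] (hT : 0 ≤ T)
    (hq : IntegrableOn q (Ioo 0 T)) (hq2 : IntegrableOn (fun s => ‖q s‖ ^ 2) (Ioo 0 T)) :
    ∃ W : ℝ → ℝ → E, StronglyMeasurable (fun z : ℝ × ℝ => W z.1 z.2) ∧
      (∃ C, ∀ x t, ‖W x t‖ ≤ C) ∧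
      ∀ x t, 0 ≤ t → t ≤ x → x ≤ T →
        (∫ v in t..x, (v - t) • W x v) - ∫ y in t..x, (x - y) • W y t =
        ∫ s in t..x, (x - s) • (q s * ((s - t) • (1 : E) + ∫ r in t..s, (r - t) • W s r)) := by
  obtain ⟨W, hWm, ⟨C, hC⟩, hW⟩ := exists_sector_integral_equation hT hq hq2
  refine ⟨W, hWm, ⟨C, hC⟩, fun x t ht htx hxT => ?_⟩
  have hY : Integrable (fun z : ℝ × ℝ => q z.1 * W z.1 z.2) (volume.restrict (sector T)) :=
    integrable_fst_mul_sector hq hWm.aestronglyMeasurable fun z => hC _ _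
  set P₁ := wavePotential (volume.restrict (Ioo 0 T)) id id q with hP₁
  set P₂ := wavePotential (volume.restrict (sector T)) Prod.fst Prod.snd
    (fun z => q z.1 * W z.1 z.2) with hP₂
  have m₁ : StronglyMeasurable fun z : ℝ × ℝ => P₁ z.1 z.2 :=
    stronglyMeasurable_wavePotential measurable_id measurable_id hq.1
  have m₂ : StronglyMeasurable fun z : ℝ × ℝ => P₂ z.1 z.2 :=
    stronglyMeasurable_wavePotential measurable_fst measurable_snd hY.1
  have hint : ∀ {P : ℝ → ℝ → E} {c : ℝ}, StronglyMeasurable (fun z : ℝ × ℝ => P z.1 z.2) →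
      (∀ x t, ‖P x t‖ ≤ c) → ∀ {φ a b : ℝ → ℝ}, Continuous φ → Measurable a → Measurable b →
      IntervalIntegrable (fun v => φ v • P (a v) (b v)) volume t x := by
    intro P c hP hc φ a b hφ ha hb
    have h1 : IntervalIntegrable (fun v => ‖φ v‖ * c) volume t x :=
      (hφ.norm.mul continuous_const).intervalIntegrable _ _
    refine h1.mono_fun' ?_ (ae_of_all _ fun v => ?_)
    · exact hφ.aestronglyMeasurable.smul
        (hP.comp_measurable (ha.prodMk hb)).aestronglyMeasurable
    · simp only [norm_smul]; gcongr; exact hc _ _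
  have b₁ := fun x t => norm_wavePotential_le (σ := id) (ρ := id) hq x t
  have b₂ := fun x t => norm_wavePotential_le (σ := Prod.fst) (ρ := Prod.snd) hY x t
  have e₁ : ∫ v in t..x, (v - t) • W x v =
      (∫ v in t..x, (v - t) • P₁ x v) + ∫ v in t..x, (v - t) • P₂ x v := by
    rw [← intervalIntegral.integral_add
      (hint m₁ b₁ (φ := fun v => v - t) (a := fun _ => x) (b := fun v => v)
        (by fun_prop) measurable_const measurable_id)
      (hint m₂ b₂ (φ := fun v => v - t) (a := fun _ => x) (b := fun v => v)
        (by fun_prop) measurable_const measurable_id)]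
    refine intervalIntegral.integral_congr fun v hv => ?_
    rw [uIcc_of_le htx] at hv
    rw [hW x ⟨ht.trans htx, hxT⟩ v ⟨by linarith [hv.1], hv.2.trans hxT⟩, smul_add]
  have e₂ : ∫ y in t..x, (x - y) • W y t =
      (∫ y in t..x, (x - y) • P₁ y t) + ∫ y in t..x, (x - y) • P₂ y t := by
    rw [← intervalIntegral.integral_add
      (hint m₁ b₁ (φ := fun y => x - y) (a := fun y => y) (b := fun _ => t)
        (by fun_prop) measurable_id measurable_const)
      (hint m₂ b₂ (φ := fun y => x - y) (a := fun y => y) (b := fun _ => t)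
        (by fun_prop) measurable_id measurable_const)]
    refine intervalIntegral.integral_congr fun y hy => ?_
    rw [uIcc_of_le htx] at hy
    rw [hW y ⟨by linarith [hy.1], hy.2.trans hxT⟩ t ⟨by linarith, by linarith⟩, smul_add]
  have i₁ := wavePotential_moment_identity measurable_id measurable_id hq
    ((ae_restrict_mem measurableSet_Ioo).mono fun s hs => (abs_of_pos hs.1).le) htx
  have i₂ := wavePotential_moment_identity measurable_fst measurable_snd hY
    ((ae_restrict_mem (measurableSet_sector T)).mono fun s hs => hs.2.2) htx
  have e₃ : ∫ s in Ioo 0 T, (max (x - id s) 0 * max (id s - t) 0) • q s =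
      ∫ s in t..x, (x - s) • (q s * ((s - t) • (1 : E))) := by
    rw [intervalIntegral.integral_of_le htx, ← integral_Ico_eq_integral_Ioc,
      integral_Ico_eq_integral_Ioo]
    refine (setIntegral_eq_of_subset_of_forall_sdiff_eq_zero (s := Ioo t x) measurableSet_Ioo
      (Ioo_subset_Ioo ht hxT) ?_).trans ?_
    · intro s hs
      simp only [id]
      rcases le_or_gt s t with h | h
      · rw [max_eq_right (by linarith : s - t ≤ 0), mul_zero, zero_smul]
      · rcases le_or_gt x s with h' | h'
        · rw [max_eq_right (by linarith : x - s ≤ 0), zero_mul, zero_smul]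
        · exact absurd ⟨h, h'⟩ hs.2
    · refine setIntegral_congr_fun measurableSet_Ioo fun s hs => ?_
      simp only [id]
      rw [max_eq_left (by linarith [hs.2]), max_eq_left (by linarith [hs.1]), mul_smul,
        mul_smul_comm, mul_one]
  set F : ℝ × ℝ → E := fun z => (max (x - z.1) 0 * max (z.2 - t) 0) • (q z.1 * W z.1 z.2) with hF
  have hFi : Integrable F (volume.restrict (sector T)) := by
    refine (hY.norm.const_mul (T * T)).mono' (AEStronglyMeasurable.fun_smul
      (Continuous.aestronglyMeasurable (by fun_prop)) hY.1) ?_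
    filter_upwards [ae_restrict_mem (measurableSet_sector T)] with z hz
    rw [hF, norm_smul, Real.norm_of_nonneg (by positivity)]
    have h1 : max (x - z.1) 0 ≤ T := max_le (by linarith [hz.1]) hT
    have h2 : max (z.2 - t) 0 ≤ T := max_le (by linarith [le_abs_self z.2, hz.2.1, hz.2.2]) hT
    gcongr
  have hFi' : Integrable ((sector T).indicator F) ((volume : Measure ℝ).prod volume) := by
    rw [← Measure.volume_eq_prod, integrable_indicator_iff (measurableSet_sector T)]
    exact hFi
  -- The positive parts restrict the sector to t < r ≤ s < x. Since t ≥ 0, the part of the sector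
  -- with r < 0, needed to construct W, no longer contributes.
  have hinner : ∀ s, ∫ r, (sector T).indicator F (s, r) =
      (Ioc t x).indicator (fun s => (x - s) • (q s * ∫ r in t..s, (r - t) • W s r)) s := by
    intro s
    by_cases hs : t < s ∧ s < x
    · rw [indicator_of_mem (show s ∈ Ioc t x from ⟨hs.1, hs.2.le⟩)]
      have h1 : ∀ r, (sector T).indicator F (s, r) =
          (Ioc t s).indicator (fun r => (x - s) • (q s * ((r - t) • W s r))) r := by
        intro r
        by_cases hr : r ∈ Ioc t s
        · have hmem : (s, r) ∈ sector T :=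
            show 0 < s ∧ s < T ∧ |r| ≤ s from ⟨by linarith [hs.1], by linarith [hs.2], by
              rw [abs_of_pos (by linarith [hr.1])]; exact hr.2⟩
          rw [indicator_of_mem hr, indicator_of_mem hmem, hF]
          simp only
          rw [max_eq_left (by linarith [hs.2]), max_eq_left (by linarith [hr.1]), mul_smul,
            mul_smul_comm]
        · rw [indicator_of_notMem hr]
          refine indicator_apply_eq_zero.2 fun hmem => ?_
          have hrt : r ≤ t := by
            by_contra h
            exact hr ⟨not_le.1 h, (le_abs_self r).trans hmem.2.2⟩
          rw [hF]
          simp only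
          rw [max_eq_right (by linarith : r - t ≤ 0), mul_zero, zero_smul]
      have h2 : IntegrableOn (fun r => (r - t) • W s r) (Ioc t s) := by
        have h3 : IntegrableOn (fun r => ‖r - t‖ * C) (Ioc t s) :=
          ((by fun_prop : Continuous fun r => ‖r - t‖ * C).integrableOn_Icc).mono_set
            Ioc_subset_Icc_self
        refine Integrable.mono' h3 (AEStronglyMeasurable.fun_smul
          (Continuous.aestronglyMeasurable (by fun_prop))
          (hWm.comp_measurable (measurable_const.prodMk measurable_id)).aestronglyMeasurable)
          (ae_of_all _ fun r => ?_)
        rw [norm_smul]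
        gcongr
        exact hC _ _
      simp only [h1]
      rw [integral_indicator measurableSet_Ioc, integral_smul,
        integral_const_mul_of_integrable h2, ← intervalIntegral.integral_of_le hs.1.le]
    · have h1 : ∀ r, (sector T).indicator F (s, r) = 0 := by
        intro r
        refine indicator_apply_eq_zero.2 fun hmem => ?_
        rw [hF]
        simp only
        rcases le_or_gt s t with h | h
        · have := (le_abs_self r).trans hmem.2.2
          rw [max_eq_right (by simp only at this; linarith : r - t ≤ 0), mul_zero, zero_smul]
        · have : x ≤ s := not_lt.1 fun h' => hs ⟨h, h'⟩
          rw [max_eq_right (by linarith : x - s ≤ 0), zero_mul, zero_smul]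
      simp only [h1, integral_zero]
      refine (indicator_apply_eq_zero.2 fun h => ?_).symm
      have : x = s := le_antisymm (not_lt.1 fun h' => hs ⟨h.1, h'⟩) h.2
      rw [this, sub_self, zero_smul]
  have e₄ : ∫ z in sector T, F z =
      ∫ s in t..x, (x - s) • (q s * ∫ r in t..s, (r - t) • W s r) := by
    rw [← integral_indicator (measurableSet_sector T), Measure.volume_eq_prod,
      integral_prod _ hFi', intervalIntegral.integral_of_le htx,
      ← integral_indicator measurableSet_Ioc]
    simp only [hinner]
  have j₁ : IntervalIntegrable (fun s => (x - s) • (q s * ((s - t) • (1 : E)))) volume t x := by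
    have h1 : IntervalIntegrable q volume t x := by
      rw [intervalIntegrable_iff_integrableOn_Ioo_of_le htx]
      exact hq.mono_set (Ioo_subset_Ioo ht hxT)
    refine (h1.continuousOn_smul (f := fun s => (x - s) * (s - t))
      (by fun_prop : Continuous fun s => (x - s) * (s - t)).continuousOn).congr ?_
    intro s _
    simp only [mul_smul, mul_smul_comm, mul_one]
  have j₂ : IntervalIntegrable (fun s => (x - s) • (q s * ∫ r in t..s, (r - t) • W s r))
      volume t x := by
    have h1 := hFi'.integral_prod_left
    simp only [hinner] at h1
    rw [integrable_indicator_iff measurableSet_Ioc] at h1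
    rwa [intervalIntegrable_iff_integrableOn_Ioc_of_le htx]
  rw [e₁, e₂, add_sub_add_comm, i₁, i₂, e₃, e₄, ← intervalIntegral.integral_add j₁ j₂]
  simp only [mul_add, smul_add]

end

/-! ### Composition of Volterra kernels and the intertwining relation -/

section
variable {p : ℕ} {T : ℝ}

theorem IsBddKernel.mono {k : ℝ → ℝ → Matrix (Fin p) (Fin p) ℂ} (hk : IsBddKernel T k) {x : ℝ}
    (hx : x ≤ T) : IsBddKernel x k := by
  obtain ⟨C, hC⟩ := hk.bounded
  exact ⟨hk.aestronglyMeasurable.mono_measure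
    (Measure.restrict_mono (show triangle x ⊆ triangle T from
      fun z hz => ⟨hz.1, hz.2.1, hz.2.2.trans hx⟩) le_rfl),
    C, fun y t h0 h1 h2 => hC y t h0 h1 (h2.trans hx)⟩

theorem IsBddKernel.indicator_aestronglyMeasurable {k : ℝ → ℝ → Matrix (Fin p) (Fin p) ℂ}
    (hk : IsBddKernel T k) :
    AEStronglyMeasurable ((triangle T).indicator fun z : ℝ × ℝ => k z.1 z.2)
      ((volume.restrict (Ioo 0 T)).prod (volume.restrict (Ioo 0 T))) := by
  rw [aestronglyMeasurable_indicator_iff (measurableSet_triangle T)]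
  refine hk.aestronglyMeasurable.mono_measure (Measure.restrict_mono_measure ?_ _)
  rw [Measure.prod_restrict]
  exact Measure.restrict_le_self

/-- Fubini for a product of two kernels in which l is merely integrable, as it must be to allow an
L² potential, while K is bounded. -/
theorem integral_mulVec_integral_swap {ν : Measure ℝ} [SFinite ν]
    {l : ℝ → Matrix (Fin p) (Fin p) ℂ} {h : ℝ → EuclideanSpace ℂ (Fin p)}
    {K : ℝ × ℝ → Matrix (Fin p) (Fin p) ℂ} (hl : Integrable l ν) (hh : Integrable h ν)
    (hK : AEStronglyMeasurable K (ν.prod ν)) {C : ℝ} (hC : ∀ z, ‖K z‖ ≤ C) :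
    Integrable (fun t => Matrix.toEuclideanLin (∫ s, l s * K (s, t) ∂ν) (h t)) ν ∧
    (∫ s, Matrix.toEuclideanLin (l s) (∫ t, Matrix.toEuclideanLin (K (s, t)) (h t) ∂ν) ∂ν) =
      ∫ t, Matrix.toEuclideanLin (∫ s, l s * K (s, t) ∂ν) (h t) ∂ν := by
  have hC0 : 0 ≤ C := (norm_nonneg _).trans (hC 0)
  have i₀ : Integrable (fun z : ℝ × ℝ => ‖l z.1‖ * ‖h z.2‖) (ν.prod ν) := hl.norm.mul_prod hh.norm
  have hlm : AEStronglyMeasurable (fun z : ℝ × ℝ => l z.1) (ν.prod ν) := hl.1.comp_fst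
  have hhm : AEStronglyMeasurable (fun z : ℝ × ℝ => h z.2) (ν.prod ν) := hh.1.comp_snd
  have hlK : AEStronglyMeasurable (fun z : ℝ × ℝ => l z.1 * K z) (ν.prod ν) := hlm.mul hK
  have i₁ : Integrable (fun z : ℝ × ℝ => Matrix.toEuclideanLin (l z.1 * K z) (h z.2))
      (ν.prod ν) := by
    refine (i₀.const_mul C).mono' ((mulVecBilin p).aestronglyMeasurable_comp₂ hlK hhm)
      (ae_of_all _ fun z => ?_)
    refine (norm_toEuclideanLin_le _ _).trans ?_
    calc ‖l z.1 * K z‖ * ‖h z.2‖ ≤ ‖l z.1‖ * C * ‖h z.2‖ := by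
          gcongr; exact (norm_mul_le _ _).trans (by gcongr; exact hC z)
      _ = _ := by ring
  have a₁ : ∀ᵐ s ∂ν, Matrix.toEuclideanLin (l s) (∫ t, Matrix.toEuclideanLin (K (s, t)) (h t) ∂ν)
      = ∫ t, Matrix.toEuclideanLin (l s * K (s, t)) (h t) ∂ν := by
    filter_upwards [hK.prodMk_left] with s hs
    have i₂ : Integrable (fun t => Matrix.toEuclideanLin (K (s, t)) (h t)) ν :=
      (hh.norm.const_mul C).mono' ((mulVecBilin p).aestronglyMeasurable_comp₂ hs hh.1)
        (ae_of_all _ fun t => (norm_toEuclideanLin_le _ _).trans (by gcongr; exact hC _))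
    have := ((mulVecBilin p) (l s)).integral_comp_comm i₂
    refine this.symm.trans (integral_congr_ae (ae_of_all _ fun t => ?_))
    change Matrix.toEuclideanLin (l s) (Matrix.toEuclideanLin (K (s, t)) (h t)) = _
    simp [Matrix.toLpLin_apply]
  have a₂ : ∀ᵐ t ∂ν, Matrix.toEuclideanLin (∫ s, l s * K (s, t) ∂ν) (h t) =
      ∫ s, Matrix.toEuclideanLin (l s * K (s, t)) (h t) ∂ν := by
    filter_upwards [hK.prod_swap.prodMk_left] with t ht
    have i₃ : Integrable (fun s => l s * K (s, t)) ν :=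
      (hl.norm.mul_const C).mono' (hl.1.mul ht)
        (ae_of_all _ fun s => (norm_mul_le _ _).trans (by gcongr; exact hC _))
    exact (((mulVecBilin p).flip (h t)).integral_comp_comm i₃).symm
  refine ⟨i₁.integral_prod_right.congr (a₂.mono fun t ht => ht.symm), ?_⟩
  rw [integral_congr_ae a₁, integral_congr_ae a₂]
  exact integral_integral_swap i₁

theorem integral_volterraFun_swap {k : ℝ → ℝ → Matrix (Fin p) (Fin p) ℂ} (hk : IsBddKernel T k)
    {x : ℝ} (hx : x ∈ Icc 0 T) {l : ℝ → Matrix (Fin p) (Fin p) ℂ} (hl : IntegrableOn l (Ioo 0 x))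
    {h : ℝ → EuclideanSpace ℂ (Fin p)} (hh : IntegrableOn h (Ioo 0 T)) :
    IntervalIntegrable (fun t => Matrix.toEuclideanLin (∫ s in t..x, l s * k s t) (h t))
      volume 0 x ∧
    (∫ s in (0 : ℝ)..x, Matrix.toEuclideanLin (l s) (volterraFun k h s)) =
      ∫ t in (0 : ℝ)..x, Matrix.toEuclideanLin (∫ s in t..x, l s * k s t) (h t) := by
  replace hk := hk.mono hx.2
  obtain ⟨C, hC⟩ := hk.bounded
  have hC' : ∀ z, ‖(triangle x).indicator (fun z : ℝ × ℝ => k z.1 z.2) z‖ ≤ |C| := by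
    intro z
    by_cases hz : z ∈ triangle x
    · rw [indicator_of_mem hz]
      exact (hC _ _ hz.1 hz.2.1 hz.2.2).trans (le_abs_self C)
    · rw [indicator_of_notMem hz, norm_zero]
      exact abs_nonneg C
  obtain ⟨h1, h2⟩ := integral_mulVec_integral_swap hl
    (hh.mono_set (Ioo_subset_Ioo_right hx.2)) hk.indicator_aestronglyMeasurable hC'
  have e₁ : ∀ s ∈ Ioo 0 x, ∫ t in Ioo 0 x, Matrix.toEuclideanLin
      ((triangle x).indicator (fun z : ℝ × ℝ => k z.1 z.2) (s, t)) (h t) = volterraFun k h s := by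
    intro s hs
    rw [volterraFun_eq hs]
    congr 1
    ext1 t
    by_cases hz : (s, t) ∈ triangle x
    · rw [indicator_of_mem hz, indicator_of_mem hz]
    · rw [indicator_of_notMem hz, indicator_of_notMem hz, map_zero, LinearMap.zero_apply]
  have e₂ : ∀ t ∈ Ioo 0 x, ∫ s in Ioo 0 x,
      l s * (triangle x).indicator (fun z : ℝ × ℝ => k z.1 z.2) (s, t) =
      ∫ s in t..x, l s * k s t := by
    intro t ht
    rw [intervalIntegral.integral_of_le ht.2.le, ← integral_Ico_eq_integral_Ioc]
    refine (setIntegral_eq_of_subset_of_forall_sdiff_eq_zero (s := Ico t x) measurableSet_Ioo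
      (fun s hs => ⟨ht.1.trans_le hs.1, hs.2⟩) ?_).trans
      (setIntegral_congr_fun measurableSet_Ico fun s hs => ?_)
    · intro s hs
      rw [indicator_of_notMem, mul_zero]
      exact fun hz => hs.2 ⟨hz.2.1, hs.1.2⟩
    · rw [indicator_of_mem (show (s, t) ∈ triangle x from ⟨ht.1.le, hs.1, hs.2.le⟩)]
  refine ⟨?_, ?_⟩
  · rw [intervalIntegrable_iff_integrableOn_Ioo_of_le hx.1]
    refine h1.congr ?_
    filter_upwards [ae_restrict_mem measurableSet_Ioo] with t ht
    rw [e₂ t ht]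
  · rw [intervalIntegral.integral_of_le hx.1, intervalIntegral.integral_of_le hx.1,
      integral_Ioc_eq_integral_Ioo, integral_Ioc_eq_integral_Ioo]
    refine (setIntegral_congr_fun measurableSet_Ioo fun s hs => ?_).trans
      (h2.trans (setIntegral_congr_fun measurableSet_Ioo fun t ht => ?_))
    · simp only [e₁ s hs]
    · simp only [e₂ t ht]

theorem norm_volterraFun_le_integral {k : ℝ → ℝ → Matrix (Fin p) (Fin p) ℂ} {C : ℝ}
    (hC : ∀ x t : ℝ, 0 ≤ t → t ≤ x → x ≤ T → ‖k x t‖ ≤ C)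
    {h : ℝ → EuclideanSpace ℂ (Fin p)} (hh : IntegrableOn h (Ioo 0 T)) {x : ℝ}
    (hx : x ∈ Icc 0 T) : ‖volterraFun k h x‖ ≤ |C| * ∫ t in Ioo 0 T, ‖h t‖ := by
  have hsub : Ioo 0 x ⊆ Ioo 0 T := Ioo_subset_Ioo_right hx.2
  rw [volterraFun, intervalIntegral.integral_of_le hx.1, integral_Ioc_eq_integral_Ioo]
  calc _ ≤ ∫ t in Ioo 0 x, |C| * ‖h t‖ := by
        refine norm_integral_le_of_norm_le ((hh.mono_set hsub).norm.const_mul _) ?_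
        filter_upwards [ae_restrict_mem measurableSet_Ioo] with t ht
        refine (norm_toEuclideanLin_le _ _).trans ?_
        gcongr
        exact (hC x t ht.1.le ht.2.le hx.2).trans (le_abs_self C)
    _ = |C| * ∫ t in Ioo 0 x, ‖h t‖ := integral_const_mul _ _
    _ ≤ _ := by
        refine mul_le_mul_of_nonneg_left ?_ (abs_nonneg C)
        exact setIntegral_mono_set hh.norm (ae_of_all _ fun _ => norm_nonneg _) hsub.eventuallyLE

theorem integrableOn_volterraFun {k : ℝ → ℝ → Matrix (Fin p) (Fin p) ℂ} (hk : IsBddKernel T k)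
    {h : ℝ → EuclideanSpace ℂ (Fin p)} (hh : IntegrableOn h (Ioo 0 T)) :
    IntegrableOn (volterraFun k h) (Ioo 0 T) := by
  obtain ⟨C, hC⟩ := hk.bounded
  refine Integrable.of_bound (volterraFun_aestronglyMeasurable hk hh.1)
    (|C| * ∫ t in Ioo 0 T, ‖h t‖) ?_
  filter_upwards [ae_restrict_mem measurableSet_Ioo] with x hx
  exact norm_volterraFun_le_integral hC hh (Ioo_subset_Icc_self hx)

theorem kernelA_mul (x t : ℝ) (M : Matrix (Fin p) (Fin p) ℂ) :
    kernelA p x t * M = (t - x) • M := by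
  rw [kernelA, smul_mul_assoc, one_mul]
  exact Complex.coe_smul _ _

theorem mul_kernelA (x t : ℝ) (M : Matrix (Fin p) (Fin p) ℂ) :
    M * kernelA p x t = (t - x) • M := by
  rw [kernelA, mul_smul_comm, mul_one]
  exact Complex.coe_smul _ _

end

section
variable {p : ℕ} {T : ℝ}

theorem IsBddKernel.of_stronglyMeasurable {W : ℝ → ℝ → Matrix (Fin p) (Fin p) ℂ}
    (hW : StronglyMeasurable fun z : ℝ × ℝ => W z.1 z.2) {C : ℝ} (hC : ∀ x t, ‖W x t‖ ≤ C) :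
    IsBddKernel T W :=
  ⟨hW.aestronglyMeasurable, C, fun x t _ _ _ => hC x t⟩

/-- The function in question is the kernel of (I+W)A. -/
theorem isBddKernel_kernelA_add_integral {W : ℝ → ℝ → Matrix (Fin p) (Fin p) ℂ}
    (hW : StronglyMeasurable fun z : ℝ × ℝ => W z.1 z.2) {C : ℝ} (hC : ∀ x t, ‖W x t‖ ≤ C) :
    IsBddKernel T fun x t => kernelA p x t + ∫ s in t..x, W x s * kernelA p s t := by
  obtain ⟨CA, hCA⟩ := (isBddKernel_kernelA p T).bounded
  have hA : Continuous fun z : ℝ × ℝ => kernelA p z.1 z.2 := by unfold kernelA; fun_prop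
  refine ⟨hA.aestronglyMeasurable.add ?_, CA + C * CA * T, fun x t h0 h1 h2 => ?_⟩
  · have hm : StronglyMeasurable fun z : ℝ × ℝ =>
        ∫ s, {w : (ℝ × ℝ) × ℝ | w.1.2 < w.2 ∧ w.2 ≤ w.1.1}.indicator
          (fun w => W w.1.1 w.2 * kernelA p w.2 w.1.2) (z, s) := by
      refine StronglyMeasurable.integral_prod_right (StronglyMeasurable.indicator ?_ ?_)
      · exact (hW.comp_measurable ((measurable_fst.comp measurable_fst).prodMk measurable_snd)).mul
          (hA.stronglyMeasurable.comp_measurable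
            (measurable_snd.prodMk (measurable_snd.comp measurable_fst)))
      · exact (measurableSet_lt (measurable_snd.comp measurable_fst) measurable_snd).inter
          (measurableSet_le measurable_snd (measurable_fst.comp measurable_fst))
    refine hm.aestronglyMeasurable.congr ?_
    filter_upwards [ae_restrict_mem (measurableSet_triangle T)] with z hz
    rw [intervalIntegral.integral_of_le hz.2.1, ← integral_indicator measurableSet_Ioc]
    rfl
  · refine (norm_add_le _ _).trans (add_le_add (hCA x t h0 h1 h2) ?_)
    have hC0 : 0 ≤ C := (norm_nonneg _).trans (hC 0 0)
    have hCA0 : 0 ≤ CA := (norm_nonneg _).trans (hCA x t h0 h1 h2)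
    refine (intervalIntegral.norm_integral_le_of_norm_le_const (C := C * CA)
      fun s hs => ?_).trans ?_
    · rw [uIoc_of_le h1] at hs
      refine (norm_mul_le _ _).trans ?_
      gcongr
      · exact hC _ _
      · exact hCA _ _ h0 hs.1.le (hs.2.trans h2)
    · gcongr
      rw [abs_of_nonneg (by linarith)]
      linarith

/-- A kernel with `k(x,t) = (t - x) I_p + ∫_t^x (x - s) q(s) k(s,t) ds` is intertwined with `A` by
an operator `I + ∫_0^x W(x,t) · dt` with a bounded kernel. -/
theorem exists_intertwining_kernel (hT : 0 ≤ T) {q : ℝ → Matrix (Fin p) (Fin p) ℂ}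
    (hq : IntegrableOn q (Ioo 0 T)) (hq2 : IntegrableOn (fun s => ‖q s‖ ^ 2) (Ioo 0 T))
    {k : ℝ → ℝ → Matrix (Fin p) (Fin p) ℂ} (hk : IsBddKernel T k)
    (hkq : ∀ x t, 0 ≤ t → t ≤ x → x ≤ T →
      k x t = kernelA p x t + ∫ s in t..x, ((x - s) • q s) * k s t) :
    ∃ W : ℝ → ℝ → Matrix (Fin p) (Fin p) ℂ, IsBddKernel T W ∧
      ∀ f : ℝ → EuclideanSpace ℂ (Fin p), IntegrableOn f (Ioo 0 T) → ∀ x ∈ Ioo 0 T,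
        volterraFun k (fun s => f s + volterraFun W f s) x =
          volterraFun (kernelA p) f x + volterraFun W (volterraFun (kernelA p) f) x := by
  obtain ⟨W, hWm, ⟨C, hC⟩, hW⟩ := exists_transmutation_kernel hT hq hq2
  have hWk : IsBddKernel T W := IsBddKernel.of_stronglyMeasurable hWm hC
  refine ⟨W, hWk, fun f hf => ?_⟩
  have hA := isBddKernel_kernelA p T
  set c : ℝ → ℝ → Matrix (Fin p) (Fin p) ℂ :=
    fun x t => kernelA p x t + ∫ s in t..x, W x s * kernelA p s t with hc
  have hck : IsBddKernel T c := isBddKernel_kernelA_add_integral hWm hC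
  set g := volterraFun (kernelA p) f with hg
  set h : ℝ → EuclideanSpace ℂ (Fin p) := fun s => f s + volterraFun W f s with hh
  have hgi : IntegrableOn g (Ioo 0 T) := integrableOn_volterraFun hA hf
  have hWfi : IntegrableOn (volterraFun W f) (Ioo 0 T) := integrableOn_volterraFun hWk hf
  have hhi : IntegrableOn h (Ioo 0 T) := hf.add hWfi
  have hql : ∀ x ∈ Icc 0 T, IntegrableOn (fun s => (x - s) • q s) (Ioo 0 x) := by
    intro x hx
    have h1 : IntegrableOn q (Icc 0 x) := by
      rw [integrableOn_Icc_iff_integrableOn_Ioo]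
      exact hq.mono_set (Ioo_subset_Ioo_right hx.2)
    exact (h1.continuousOn_smul (f := fun s => x - s) (by fun_prop) isCompact_Icc).mono_set
      Ioo_subset_Icc_self
  have hAf : ∀ {f : ℝ → EuclideanSpace ℂ (Fin p)}, IntegrableOn f (Ioo 0 T) → ∀ x ∈ Icc 0 T,
      IntervalIntegrable (fun t => Matrix.toEuclideanLin (kernelA p x t) (f t)) volume 0 x := by
    intro f hf x hx
    have h1 : IntervalIntegrable f volume 0 x := by
      rw [intervalIntegrable_iff_integrableOn_Ioo_of_le hx.1]
      exact hf.mono_set (Ioo_subset_Ioo_right hx.2)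
    refine (h1.continuousOn_smul (f := fun t => t - x) (by fun_prop)).congr fun t _ => ?_
    rw [kernelA, map_smul, LinearMap.smul_apply, Complex.coe_smul]
    simp
  -- `K h = A h + ∫ (x - s) q K h`
  have s₁ : ∀ x ∈ Icc 0 T, volterraFun k h x = volterraFun (kernelA p) h x +
      ∫ s in (0 : ℝ)..x, Matrix.toEuclideanLin ((x - s) • q s) (volterraFun k h s) := by
    intro x hx
    obtain ⟨h1, h2⟩ := integral_volterraFun_swap hk hx (hql x hx) hhi
    rw [h2, volterraFun, volterraFun, ← intervalIntegral.integral_add (hAf hhi x hx) h1]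
    refine intervalIntegral.integral_congr fun t ht => ?_
    rw [uIcc_of_le hx.1] at ht
    rw [hkq x t ht.1 ht.2 hx.2, map_add toEuclideanLin, LinearMap.add_apply]
  -- The right side of the intertwining relation, (I+W)Af, as one integral operator with kernel c.
  have s₂ : ∀ x ∈ Icc 0 T, g x + volterraFun W g x = volterraFun c f x := by
    intro x hx
    obtain ⟨h1, h2⟩ := integral_volterraFun_swap hA hx (l := fun s => W x s)
      (Integrable.of_bound (hWm.comp_measurable
        (measurable_const.prodMk measurable_id)).aestronglyMeasurable C
        (ae_of_all _ fun s => hC x s)) hf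
    rw [volterraFun, h2, hg, volterraFun, volterraFun,
      ← intervalIntegral.integral_add (hAf hf x hx) h1]
    simp only [hc, map_add, LinearMap.add_apply]
  -- The transmutation identity with all signs reversed: WA = AW + Qc at the level of kernels.
  have kid : ∀ x t, 0 ≤ t → t ≤ x → x ≤ T → ∫ s in t..x, W x s * kernelA p s t =
      (∫ s in t..x, kernelA p x s * W s t) + ∫ s in t..x, ((x - s) • q s) * c s t := by
    intro x t h0 h1 h2
    have h3 := hW x t h0 h1 h2
    have e₁ : ∫ s in t..x, W x s * kernelA p s t = - ∫ v in t..x, (v - t) • W x v := by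
      rw [← intervalIntegral.integral_neg]
      simp only [mul_kernelA, ← neg_smul, neg_sub]
    have e₂ : ∫ s in t..x, kernelA p x s * W s t = - ∫ y in t..x, (x - y) • W y t := by
      rw [← intervalIntegral.integral_neg]
      simp only [kernelA_mul, ← neg_smul, neg_sub]
    have e₃ : ∫ s in t..x, ((x - s) • q s) * c s t = - ∫ s in t..x, (x - s) •
        (q s * ((s - t) • (1 : Matrix (Fin p) (Fin p) ℂ) + ∫ r in t..s, (r - t) • W s r)) := by
      rw [← intervalIntegral.integral_neg]
      congr 1
      ext1 s
      have e₄ : c s t = -((s - t) • (1 : Matrix (Fin p) (Fin p) ℂ) +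
          ∫ r in t..s, (r - t) • W s r) := by
        simp only [hc]
        rw [neg_add, ← intervalIntegral.integral_neg, ← mul_one (kernelA p s t), kernelA_mul]
        simp only [mul_kernelA, ← neg_smul, neg_sub]
      rw [e₄, mul_neg, smul_mul_assoc]
    rw [e₁, e₂, e₃, ← h3]
    abel
  -- The function (I+W)Af satisfies the same equation, with the same inhomogeneous term Ah, as kh
  -- does in `s₁`.
  have s₃ : ∀ x ∈ Icc 0 T, volterraFun c f x = volterraFun (kernelA p) h x +
      ∫ s in (0 : ℝ)..x, Matrix.toEuclideanLin ((x - s) • q s) (volterraFun c f s) := by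
    intro x hx
    have hAx : Continuous fun s => kernelA p x s := by unfold kernelA; fun_prop
    obtain ⟨h1, h2⟩ := integral_volterraFun_swap hWk hx (l := fun s => kernelA p x s)
      (hAx.integrableOn_Icc.mono_set Ioo_subset_Icc_self) hf
    obtain ⟨h3, h4⟩ := integral_volterraFun_swap hck hx (hql x hx) hf
    have e₁ : volterraFun (kernelA p) h x =
        volterraFun (kernelA p) f x + volterraFun (kernelA p) (volterraFun W f) x := by
      rw [volterraFun, volterraFun, volterraFun,
        ← intervalIntegral.integral_add (hAf hf x hx) (hAf hWfi x hx)]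
      simp only [hh, map_add]
    have e₂ : volterraFun (kernelA p) (volterraFun W f) x =
        ∫ t in (0 : ℝ)..x, Matrix.toEuclideanLin (∫ s in t..x, kernelA p x s * W s t) (f t) := h2
    rw [e₁, e₂, h4, volterraFun, volterraFun, add_assoc, ← intervalIntegral.integral_add h1 h3,
      ← intervalIntegral.integral_add (hAf hf x hx) (h1.add h3)]
    refine intervalIntegral.integral_congr fun t ht => ?_
    rw [uIcc_of_le hx.1] at ht
    simp only [hc]
    rw [kid x t ht.1 ht.2 hx.2]
    simp only [map_add, LinearMap.add_apply, hc]
  obtain ⟨Ck, hCk⟩ := hk.bounded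
  obtain ⟨Cc, hCc⟩ := hck.bounded
  set B := |Ck| * (∫ t in Ioo 0 T, ‖h t‖) + |Cc| * ∫ t in Ioo 0 T, ‖f t‖ with hB
  obtain ⟨l, hl0, hl⟩ := exists_exp_weight (g := fun s => T * ‖q s‖) (hq.norm.const_mul T)
    ((hq2.const_mul (T ^ 2)).congr (ae_of_all _ fun s => by ring))
  have hdB : ∀ x : Icc (0 : ℝ) T, ‖volterraFun k h x - volterraFun c f x‖ ≤ B := fun x =>
    (norm_sub_le _ _).trans (add_le_add (norm_volterraFun_le_integral hCk hhi x.2)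
      (norm_volterraFun_le_integral hCc hf x.2))
  have hB0 : 0 ≤ B := (norm_nonneg _).trans (hdB ⟨0, le_rfl, hT⟩)
  have hli : ∀ {v : ℝ → EuclideanSpace ℂ (Fin p)} {b : ℝ}, AEStronglyMeasurable v
      (volume.restrict (Ioo 0 T)) → (∀ s ∈ Icc 0 T, ‖v s‖ ≤ b) → ∀ x ∈ Icc 0 T,
      IntervalIntegrable (fun s => Matrix.toEuclideanLin ((x - s) • q s) (v s)) volume 0 x := by
    intro v b hv hb x hx
    have hsub : Ioo 0 x ⊆ Ioo 0 T := Ioo_subset_Ioo_right hx.2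
    rw [intervalIntegrable_iff_integrableOn_Ioo_of_le hx.1]
    refine Integrable.mono' ((hql x hx).norm.mul_const b)
      ((mulVecBilin p).aestronglyMeasurable_comp₂ (hql x hx).1
        (hv.mono_measure (Measure.restrict_mono hsub le_rfl))) ?_
    filter_upwards [ae_restrict_mem measurableSet_Ioo] with s hs
    refine (norm_toEuclideanLin_le _ _).trans ?_
    gcongr
    exact hb s (Ioo_subset_Icc_self (hsub hs))
  -- The difference d satisfies the homogeneous equation d = Qd. It is bounded, so the weighted
  -- estimate forces d = 0 at every point.
  have hdeq : ∀ x ∈ Icc 0 T, volterraFun k h x - volterraFun c f x =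
      ∫ s in (0 : ℝ)..x, Matrix.toEuclideanLin ((x - s) • q s)
        (volterraFun k h s - volterraFun c f s) := by
    intro x hx
    simp only [map_sub]
    rw [intervalIntegral.integral_sub
      (hli (volterraFun_aestronglyMeasurable hk hhi.1)
        (fun s hs => norm_volterraFun_le_integral hCk hhi hs) x hx)
      (hli (volterraFun_aestronglyMeasurable hck hf.1)
        (fun s hs => norm_volterraFun_le_integral hCc hf hs) x hx), s₁ x hx, s₃ x hx]
    abel
  intro x hx
  have hx' := Ioo_subset_Icc_self hx
  rw [s₂ x hx', ← sub_eq_zero]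
  refine eq_zero_of_weight (X := Icc (0 : ℝ) T) (τ := fun x => (x : ℝ)) (l := l) (C := B)
    (d := fun x => volterraFun k h x - volterraFun c f x) hB0 (fun y => (hdB y).trans ?_) ?_
    ⟨x, hx'⟩
  · exact le_mul_of_one_le_right hB0 (Real.one_le_exp (mul_nonneg hl0 y.2.1))
  · intro m hm hd y
    rw [hdeq y y.2, intervalIntegral.integral_of_le y.2.1, integral_Ioc_eq_integral_Ioo]
    have hsub : Ioo 0 (y : ℝ) ⊆ Ioo 0 T := Ioo_subset_Ioo_right y.2.2
    have hgi : IntegrableOn (fun s => T * ‖q s‖ * Real.exp (l * s)) (Ioo 0 (y : ℝ)) := by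
      rw [← integrableOn_Icc_iff_integrableOn_Ioo]
      refine IntegrableOn.mul_continuousOn ?_ (by fun_prop) isCompact_Icc
      rw [integrableOn_Icc_iff_integrableOn_Ioo]
      exact (hq.mono_set hsub).norm.const_mul T
    calc _ ≤ ∫ s in Ioo 0 (y : ℝ), m * (T * ‖q s‖ * Real.exp (l * s)) := by
          refine norm_integral_le_of_norm_le (hgi.const_mul m) ?_
          filter_upwards [ae_restrict_mem measurableSet_Ioo] with s hs
          refine (norm_toEuclideanLin_le _ _).trans ?_
          have h1 := hd ⟨s, Ioo_subset_Icc_self (hsub hs)⟩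
          have h2 : ‖(y - s) • q s‖ ≤ T * ‖q s‖ := by
            rw [norm_smul, Real.norm_of_nonneg (by linarith [hs.2])]
            gcongr
            linarith [hs.1, y.2.2]
          calc _ ≤ (T * ‖q s‖) * (m * Real.exp (l * s)) := by gcongr
            _ = _ := by ring
      _ ≤ m * (1 / 2 * Real.exp (l * y)) := by
          rw [integral_const_mul]
          gcongr
          exact hl y y.2
      _ = _ := by ring

end

/-! ### Absolutely continuous vector-valued functions -/

namespace AbsolutelyContinuousOnInterval

theorem of_dist_le {X Y : Type*} [PseudoMetricSpace X] [PseudoMetricSpace Y] {f : ℝ → X}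
    {g : ℝ → Y} {a b : ℝ} (hf : AbsolutelyContinuousOnInterval f a b) (C : ℝ)
    (hg : ∀ x ∈ uIcc a b, ∀ y ∈ uIcc a b, dist (g x) (g y) ≤ C * dist (f x) (f y)) :
    AbsolutelyContinuousOnInterval g a b := by
  unfold AbsolutelyContinuousOnInterval at hf ⊢
  refine squeeze_zero' (Filter.Eventually.of_forall fun _ => Finset.sum_nonneg fun _ _ =>
    dist_nonneg) ?_ (by simpa using hf.const_mul C)
  rw [Filter.eventually_inf_principal]
  filter_upwards with (n, I) hnI
  simp only [disjWithin, mem_ofPred_eq] at hnI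
  rw [Finset.mul_sum]
  exact Finset.sum_le_sum fun i hi => hg _ (hnI.1 i hi).1 _ (hnI.1 i hi).2

theorem integral {E : Type*} [NormedAddCommGroup E] [NormedSpace ℝ E] {f : ℝ → E} {a b c : ℝ}
    (hf : IntervalIntegrable f volume a b) (hc : c ∈ uIcc a b) :
    AbsolutelyContinuousOnInterval (fun x => ∫ s in c..x, f s) a b := by
  refine of_dist_le (hf.norm.absolutelyContinuousOnInterval_intervalIntegral hc) 1 ?_
  intro x hx y hy
  have hx' := hf.mono_set (uIcc_subset_uIcc hc hx)
  have hy' := hf.mono_set (uIcc_subset_uIcc hc hy)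
  rw [one_mul, dist_comm, dist_comm (∫ s in c..x, ‖f s‖), dist_eq_norm, Real.dist_eq,
    intervalIntegral.integral_interval_sub_left hy' hx',
    intervalIntegral.integral_interval_sub_left hy'.norm hx'.norm]
  exact intervalIntegral.norm_integral_le_abs_integral_norm

theorem bilinear {E F G : Type*} [NormedAddCommGroup E] [NormedSpace ℝ E] [NormedAddCommGroup F]
    [NormedSpace ℝ F] [NormedAddCommGroup G] [NormedSpace ℝ G] (B : E →L[ℝ] F →L[ℝ] G)
    {f : ℝ → E} {g : ℝ → F} {a b : ℝ} (hf : AbsolutelyContinuousOnInterval f a b)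
    (hg : AbsolutelyContinuousOnInterval g a b) :
    AbsolutelyContinuousOnInterval (fun x => B (f x) (g x)) a b := by
  obtain ⟨C, hC⟩ := hf.exists_bound
  obtain ⟨D, hD⟩ := hg.exists_bound
  unfold AbsolutelyContinuousOnInterval at hf hg ⊢
  refine squeeze_zero' (Filter.Eventually.of_forall fun _ => Finset.sum_nonneg fun _ _ =>
    dist_nonneg) ?_ (by simpa using (hg.const_mul (‖B‖ * C)).add (hf.const_mul (‖B‖ * D)))
  rw [Filter.eventually_inf_principal]
  filter_upwards with (n, I) hnI
  simp only [disjWithin, mem_ofPred_eq] at hnI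
  rw [Finset.mul_sum, Finset.mul_sum, ← Finset.sum_add_distrib]
  refine Finset.sum_le_sum fun i hi => ?_
  have h1 : B (f (I i).1) (g (I i).1) - B (f (I i).2) (g (I i).2) =
      B (f (I i).1) (g (I i).1 - g (I i).2) + B (f (I i).1 - f (I i).2) (g (I i).2) := by
    simp
  rw [dist_eq_norm, dist_eq_norm, dist_eq_norm, h1]
  refine (norm_add_le _ _).trans (add_le_add ?_ ?_)
  · refine (B.le_opNorm₂ _ _).trans ?_
    gcongr
    exact hC _ (hnI.1 i hi).1
  · refine (B.le_opNorm₂ _ _).trans ?_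
    rw [mul_right_comm]
    gcongr
    exact hD _ (hnI.1 i hi).2

end AbsolutelyContinuousOnInterval

/-! ### Linear differential equations and unitary solutions -/

theorem exists_linear_ode_solution {E : Type*} [NormedRing E] [NormedAlgebra ℝ E] [CompleteSpace E]
    {T : ℝ} (hT : 0 ≤ T) {G : ℝ → E} (hG : Continuous G) :
    ∃ u : ℝ → E, u 0 = 1 ∧ (∃ v : ℝ → E, Continuous v ∧ ∀ x, u x = 1 + ∫ s in (0 : ℝ)..x, v s) ∧
      ∀ x ∈ Icc 0 T, HasDerivAt u (G x * u x) x := by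
  obtain ⟨l, hl0, hl⟩ := exists_exp_weight (T := T) (g := fun s => ‖G s‖)
    (hG.norm.integrableOn_Icc.mono_set Ioo_subset_Icc_self)
    ((hG.norm.pow 2).integrableOn_Icc.mono_set Ioo_subset_Icc_self)
  -- Clamping the argument of w makes the integrand continuous on the whole line, so the primitive
  -- has two-sided derivatives even at 0 and T.
  have hcont : ∀ w : C(Icc (0 : ℝ) T, E), Continuous fun s => G s * w (projIcc 0 T hT s) :=
    fun w => hG.mul (w.continuous.comp continuous_projIcc)
  have hprim : ∀ w : C(Icc (0 : ℝ) T, E), ∀ x,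
      HasDerivAt (fun x => 1 + ∫ s in (0 : ℝ)..x, G s * w (projIcc 0 T hT s))
        (G x * w (projIcc 0 T hT x)) x := fun w x =>
    ((hcont w).integral_hasStrictDerivAt 0 x).hasDerivAt.const_add 1
  let Φ : C(Icc (0 : ℝ) T, E) → C(Icc (0 : ℝ) T, E) := fun w =>
    ⟨fun x => 1 + ∫ s in (0 : ℝ)..x, G s * w (projIcc 0 T hT s),
      (continuous_iff_continuousAt.2 fun x => (hprim w x).continuousAt).comp
        continuous_subtype_val⟩
  obtain ⟨w, hw⟩ := exists_fixedPoint_of_weight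
    (⟨fun z => z, by fun_prop⟩ : C(Icc (0 : ℝ) T, ℝ)) l Φ (by
    intro v w m hm hvw x
    have h1 : Φ v x - Φ w x = ∫ s in (0 : ℝ)..x,
        G s * (v (projIcc 0 T hT s) - w (projIcc 0 T hT s)) := by
      simp only [Φ, ContinuousMap.coe_mk, mul_sub]
      rw [intervalIntegral.integral_sub ((hcont v).intervalIntegrable _ _)
        ((hcont w).intervalIntegrable _ _)]
      abel
    rw [h1, intervalIntegral.integral_of_le x.2.1, integral_Ioc_eq_integral_Ioo]
    calc _ ≤ ∫ s in Ioo 0 (x : ℝ), m * (‖G s‖ * Real.exp (l * s)) := by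
          refine norm_integral_le_of_norm_le (Continuous.integrableOn_Icc (by fun_prop) |>.mono_set
            Ioo_subset_Icc_self) ?_
          filter_upwards [ae_restrict_mem measurableSet_Ioo] with s hs
          have h2 := hvw (projIcc 0 T hT s)
          have h3 : (projIcc 0 T hT s : ℝ) = s := by
            rw [projIcc_of_mem hT ⟨hs.1.le, hs.2.le.trans x.2.2⟩]
          simp only [ContinuousMap.coe_mk, h3] at h2
          calc _ ≤ ‖G s‖ * (m * Real.exp (l * s)) := (norm_mul_le _ _).trans (by gcongr)
            _ = _ := by ring
      _ ≤ m * (1 / 2 * Real.exp (l * x)) := by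
          rw [integral_const_mul]
          gcongr
          exact hl x x.2
      _ = _ := by simp only [ContinuousMap.coe_mk]; ring)
  refine ⟨fun x => 1 + ∫ s in (0 : ℝ)..x, G s * w (projIcc 0 T hT s), by simp,
    ⟨_, hcont w, fun x => rfl⟩, fun x hx => ?_⟩
  have h4 : w (projIcc 0 T hT x) = 1 + ∫ s in (0 : ℝ)..x, G s * w (projIcc 0 T hT s) := by
    rw [projIcc_of_mem hT hx]
    exact (DFunLike.congr_fun hw _).symm
  exact (hprim w x).congr_deriv (by rw [h4])

/-- The derivative of u^*u is u^*(G^* + G)u = 0. -/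
theorem star_mul_self_eq_one_of_skewAdjoint {E : Type*} [NormedRing E] [NormedAlgebra ℝ E]
    [StarRing E] [NormedStarGroup E] [StarModule ℝ E] {T : ℝ} {G u : ℝ → E}
    (hG : ∀ x ∈ Icc 0 T, star (G x) = -G x) (hu0 : u 0 = 1)
    (hu : ∀ x ∈ Icc 0 T, HasDerivAt u (G x * u x) x) : ∀ x ∈ Icc 0 T, star (u x) * u x = 1 := by
  intro x hx
  have h : ∀ x ∈ Icc 0 T, HasDerivAt (fun x => star (u x) * u x) 0 x := by
    intro x hx
    refine ((hu x hx).star.mul (hu x hx)).congr_deriv ?_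
    rw [star_mul, hG x hx]
    noncomm_ring
  have h1 := constant_of_has_deriv_right_zero
    (fun x hx => (h x hx).continuousAt.continuousWithinAt)
    (fun x hx => (h x (Ico_subset_Icc_self hx)).hasDerivWithinAt) x hx
  rw [h1, hu0, star_one, one_mul]

/-! ### Calculus of rectangular matrix functions -/

section
variable {l m n : Type*} [Fintype n]

/-- The continuous bilinear map `(A, B) ↦ A B` on rectangular matrices. -/
noncomputable def matrixMulBilin (l m n : Type*) [Fintype l] [Fintype m] [Fintype n]
    [DecidableEq m] [DecidableEq n] :
    Matrix l m ℂ →L[ℝ] Matrix m n ℂ →L[ℝ] Matrix l n ℂ :=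
  LinearMap.mkContinuous₂
    (LinearMap.mk₂ ℝ (fun (A : Matrix l m ℂ) (B : Matrix m n ℂ) => A * B)
      Matrix.add_mul (fun c A B => Matrix.smul_mul c A B) Matrix.mul_add
      (fun c A B => Matrix.mul_smul A c B)) 1
    (by intro A B; simpa using Matrix.l2_opNorm_mul A B)

theorem HasDerivAt.matrix_mul [Fintype l] [Fintype m] [DecidableEq m] [DecidableEq n]
    {A : ℝ → Matrix l m ℂ} {B : ℝ → Matrix m n ℂ} {A' : Matrix l m ℂ}
    {B' : Matrix m n ℂ} {x : ℝ} (hA : HasDerivAt A A' x) (hB : HasDerivAt B B' x) :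
    HasDerivAt (fun y => A y * B y) (A x * B' + A' * B x) x :=
  (matrixMulBilin l m n).hasDerivAt_of_bilinear (fun _ => hA) (fun _ => hB)

theorem hasDerivWithinAt_matrix {A : ℝ → Matrix m n ℂ} {A' : Matrix m n ℂ} {s : Set ℝ} {x : ℝ}
    (h : ∀ a b, HasDerivWithinAt (fun y => A y a b) (A' a b) s x) : HasDerivWithinAt A A' s x :=
  hasDerivWithinAt_pi.2 fun a => hasDerivWithinAt_pi.2 fun b => h a b

theorem HasDerivAt.matrix_entry {A : ℝ → Matrix m n ℂ} {A' : Matrix m n ℂ} {x : ℝ}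
    (h : HasDerivAt A A' x) (a : m) (b : n) : HasDerivAt (fun y => A y a b) (A' a b) x :=
  hasDerivAt_pi.1 (hasDerivAt_pi.1 h a) b

theorem HasDerivAt.matrix_conjTranspose [Fintype m] {A : ℝ → Matrix m n ℂ} {A' : Matrix m n ℂ}
    {x : ℝ} (h : HasDerivAt A A' x) : HasDerivAt (fun y => (A y)ᴴ) A'ᴴ x :=
  hasDerivAt_pi.2 fun a => hasDerivAt_pi.2 fun b => (h.matrix_entry b a).star

theorem memLp_matrix [Fintype m] [DecidableEq m] [DecidableEq n] {α : Type*}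
    [MeasurableSpace α] {μ : Measure α} {r : ENNReal} {A : α → Matrix m n ℂ}
    (h : ∀ a b, MemLp (fun x => A x a b) r μ) : MemLp A r μ := by
  have h1 : A = fun x => ∑ a, ∑ b, A x a b • Matrix.single a b (1 : ℂ) := by
    ext1 x
    conv_lhs => rw [Matrix.matrix_eq_sum_single (A x)]
    simp [Matrix.smul_single]
  rw [h1]
  exact memLp_finsetSum _ fun a _ => memLp_finsetSum _ fun b _ =>
    (ContinuousLinearMap.toSpanSingleton ℂ (Matrix.single a b (1 : ℂ))).comp_memLp' (h a b)

theorem matrix_intervalIntegral_apply [Fintype m] [DecidableEq n] {A : ℝ → Matrix m n ℂ} {c d : ℝ}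
    (h : IntervalIntegrable A volume c d) (a : m) (b : n) :
    (∫ s in c..d, A s) a b = ∫ s in c..d, A s a b :=
  ((LinearMap.toContinuousLinearMap (Matrix.entryLinearMap ℂ ℂ a b)).intervalIntegral_comp_comm
    h).symm

theorem norm_matrix_entry_le [Fintype m] [DecidableEq n] (A : Matrix m n ℂ) (a : m) (b : n) :
    ‖A a b‖ ≤ ‖A‖ := by
  have h := Matrix.l2_opNorm_mulVec A (EuclideanSpace.single b (1 : ℂ))
  have h2 := PiLp.norm_apply_le ((EuclideanSpace.equiv m ℂ).symm <|
    A *ᵥ (EuclideanSpace.single b (1 : ℂ))) a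
  have h3 := h2.trans h
  simpa using h3

end

/-! ### Regularity of β and expansion in the rows of β' and β -/

section
variable {p : ℕ} {T : ℝ} {β β' β'' : ℝ → Matrix (Fin p) (Fin p ⊕ Fin p) ℂ}

theorem HasL2SecondDeriv.hasDerivWithinAt_fst (h : HasL2SecondDeriv T β β' β'') {x : ℝ}
    (hx : x ∈ Icc 0 T) : HasDerivWithinAt β (β' x) (Icc 0 T) x :=
  hasDerivWithinAt_matrix (h.hasDeriv x hx)

theorem HasL2SecondDeriv.hasDerivAt_fst (h : HasL2SecondDeriv T β β' β'') {x : ℝ}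
    (hx : x ∈ Ioo 0 T) : HasDerivAt β (β' x) x :=
  (h.hasDerivWithinAt_fst (Ioo_subset_Icc_self hx)).hasDerivAt (Icc_mem_nhds hx.1 hx.2)

theorem HasL2SecondDeriv.memLp_matrix (h : HasL2SecondDeriv T β β' β'') :
    MemLp β'' 2 (volume.restrict (Ioo 0 T)) :=
  _root_.memLp_matrix h.memLp

theorem HasL2SecondDeriv.intervalIntegrable (h : HasL2SecondDeriv T β β' β'') (hT : 0 ≤ T) :
    IntervalIntegrable β'' volume 0 T := by
  rw [intervalIntegrable_iff_integrableOn_Ioo_of_le hT]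
  exact h.memLp_matrix.integrable (by norm_num)

theorem HasL2SecondDeriv.eq_add_integral (h : HasL2SecondDeriv T β β' β'') {x : ℝ}
    (hx : x ∈ Icc 0 T) : β' x = β' 0 + ∫ s in (0 : ℝ)..x, β'' s := by
  have hT : 0 ≤ T := hx.1.trans hx.2
  have hi : IntervalIntegrable β'' volume 0 x := (h.intervalIntegrable hT).mono_set
    (by rw [uIcc_of_le hx.1, uIcc_of_le hT]; exact Icc_subset_Icc_right hx.2)
  ext a b
  rw [h.eq_integral x hx a b, Matrix.add_apply, matrix_intervalIntegral_apply hi]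

theorem HasL2SecondDeriv.ae_hasDerivAt (h : HasL2SecondDeriv T β β' β'') :
    ∀ᵐ x, x ∈ Ioo 0 T → HasDerivAt β' (β'' x) x := by
  rcases le_or_gt T 0 with hT | hT
  · exact ae_of_all _ fun x hx => absurd (hx.1.trans hx.2) hT.not_gt
  filter_upwards [(h.intervalIntegrable hT.le).ae_hasDerivAt_integral] with x hx hxT
  have h1 := (hx (by rw [uIcc_of_le hT.le]; exact Ioo_subset_Icc_self hxT) 0
    left_mem_uIcc).const_add (β' 0)
  refine h1.congr_of_eventuallyEq ?_
  filter_upwards [Ioo_mem_nhds hxT.1 hxT.2] with y hy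
  exact h.eq_add_integral (Ioo_subset_Icc_self hy)

theorem HasL2SecondDeriv.absolutelyContinuous_deriv (h : HasL2SecondDeriv T β β' β'')
    (hT : 0 ≤ T) : AbsolutelyContinuousOnInterval β' 0 T := by
  refine (AbsolutelyContinuousOnInterval.integral (h.intervalIntegrable hT)
    left_mem_uIcc).of_dist_le 1 fun x hx y hy => ?_
  rw [uIcc_of_le hT] at hx hy
  rw [h.eq_add_integral hx, h.eq_add_integral hy, dist_add_left, one_mul]

theorem HasL2SecondDeriv.absolutelyContinuous (h : HasL2SecondDeriv T β β' β'') (hT : 0 ≤ T) :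
    AbsolutelyContinuousOnInterval β 0 T := by
  obtain ⟨C, hC⟩ := (h.absolutelyContinuous_deriv hT).exists_bound
  rw [uIcc_of_le hT] at hC
  refine LipschitzOnWith.absolutelyContinuousOnInterval (K := C.toNNReal) ?_
  rw [uIcc_of_le hT]
  refine (convex_Icc 0 T).lipschitzOnWith_of_nnnorm_hasDerivWithin_le
    (fun x hx => h.hasDerivWithinAt_fst hx) fun x hx => ?_
  rw [← NNReal.coe_le_coe, coe_nnnorm]
  exact (hC x hx).trans (Real.le_coe_toNNReal C)

theorem conjTranspose_jMat (p : ℕ) : (jMat p)ᴴ = jMat p := by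
  simp [jMat, Matrix.fromBlocks_conjTranspose]

/-- With S the square matrix of rows b', b, the product S j S^* has blocks b'jb'^*, i, -i, 0 and is
explicitly invertible. Hence S is invertible, and every c expands in the rows of b' and b with
coefficients given by the j-form. -/
theorem eq_mul_add_mul_of_jMat {b b' : Matrix (Fin p) (Fin p ⊕ Fin p) ℂ}
    (h0 : b * jMat p * bᴴ = 0) (h1 : b' * jMat p * bᴴ = Complex.I • (1 : Matrix _ _ ℂ))
    (c : Matrix (Fin p) (Fin p ⊕ Fin p) ℂ) :
    c = (-Complex.I • (c * jMat p * bᴴ)) * b' +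
      (Complex.I • (c * jMat p * b'ᴴ) - c * jMat p * bᴴ * (b' * jMat p * b'ᴴ)) * b := by
  have h2 : b * jMat p * b'ᴴ = -Complex.I • (1 : Matrix _ _ ℂ) := by
    have := congrArg Matrix.conjTranspose h1
    rw [Matrix.conjTranspose_mul, Matrix.conjTranspose_mul, conjTranspose_jMat,
      Matrix.conjTranspose_conjTranspose, ← Matrix.mul_assoc] at this
    simpa using this
  set S := Matrix.fromRows b' b
  -- The last factor is the inverse of S j S^*, so N is a right inverse of S; as S is square, it is
  -- also a left inverse.
  set N := jMat p * Matrix.fromCols b'ᴴ bᴴ * Matrix.fromBlocks 0 (Complex.I • 1)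
    (-Complex.I • 1) (-(b' * jMat p * b'ᴴ)) with hN
  have hSN : S * N = 1 := by
    rw [hN, ← Matrix.mul_assoc, ← Matrix.mul_assoc, Matrix.fromRows_mul,
      Matrix.fromRows_mul_fromCols, h0, h1, h2, Matrix.fromBlocks_multiply,
      ← Matrix.fromBlocks_one]
    congr 1 <;> simp [smul_smul]
  have hNS : N * S = 1 := mul_eq_one_comm.1 hSN
  have h3 : c = c * N * S := by rw [Matrix.mul_assoc, hNS, Matrix.mul_one]
  conv_lhs => rw [h3]
  rw [hN, ← Matrix.mul_assoc, ← Matrix.mul_assoc, Matrix.mul_fromCols,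
    Matrix.fromCols_mul_fromBlocks, Matrix.fromCols_mul_fromRows]
  simp [sub_eq_add_neg]

end

namespace AbsolutelyContinuousOnInterval

theorem clm {E F : Type*} [NormedAddCommGroup E] [NormedSpace ℝ E] [NormedAddCommGroup F]
    [NormedSpace ℝ F] (L : E →L[ℝ] F) {f : ℝ → E} {a b : ℝ}
    (hf : AbsolutelyContinuousOnInterval f a b) :
    AbsolutelyContinuousOnInterval (fun x => L (f x)) a b :=
  hf.of_dist_le ‖L‖ fun x _ y _ => by
    rw [dist_eq_norm, dist_eq_norm, ← map_sub]
    exact L.le_opNorm _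

/-- By Lebesgue differentiation f minus the primitive of f' is absolutely continuous with zero
derivative almost everywhere, hence constant. This form is needed because β' is differentiable only
almost everywhere. -/
theorem integral_eq_sub_of_ae_hasDerivAt {E : Type*} [NormedAddCommGroup E] [NormedSpace ℝ E]
    [CompleteSpace E] {f f' : ℝ → E} {a b : ℝ} (hf : AbsolutelyContinuousOnInterval f a b)
    (hi : IntervalIntegrable f' volume a b)
    (h : ∀ᵐ x, x ∈ uIcc a b → HasDerivAt f (f' x) x) :
    ∫ s in a..b, f' s = f b - f a := by
  have h1 : ∀ᵐ x, x ∈ uIcc a b → HasDerivAt (fun x => f x - ∫ s in a..x, f' s) 0 x := by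
    filter_upwards [h, hi.ae_hasDerivAt_integral] with x hx hx' hxm
    exact ((hx hxm).sub (hx' hxm a left_mem_uIcc)).congr_deriv (sub_self _)
  obtain ⟨C, hC⟩ := (hf.sub (integral hi left_mem_uIcc)).const_of_ae_hasDerivAt_zero h1
  have ha := hC a left_mem_uIcc
  have hb := hC b right_mem_uIcc
  simp only [Pi.sub_apply, intervalIntegral.integral_same, sub_zero] at ha hb
  rw [ha, ← hb]
  abel

end AbsolutelyContinuousOnInterval

/-! ### The second order equation for β and the unitary gauge -/

section
variable {p : ℕ} {T : ℝ} {β β' β'' : ℝ → Matrix (Fin p) (Fin p ⊕ Fin p) ℂ}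

/-- The algebra behind the gauge. For z = u^*Y with u' = (i/2)Hu and H' = X + X^*, the H Y' terms
cancel in z'' and leave z'' = qz. The left side is the expanded derivative of z + (x-s)z', with c in
the role of x - s. -/
theorem gauge_derivative_identity {p : ℕ} (c : ℂ) {U H X Y Y₁ Y₂ : Matrix (Fin p) (Fin p) ℂ}
    (hU : U * Uᴴ = 1) (hH : Hᴴ = H)
    (hY : Y₂ = (Complex.I • H) * Y₁ + (Complex.I • X + H * H) * Y) :
    Uᴴ * (Y₁ + (c • (Y₂ - (Complex.I / 2) • (H * Y₁ + (X + Xᴴ) * Y)) +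
        (-1 : ℂ) • (Y₁ - (Complex.I / 2) • (H * Y)))) +
      ((Complex.I / 2) • H * U)ᴴ * (Y + c • (Y₁ - (Complex.I / 2) • (H * Y))) =
      c • ((Uᴴ * ((Complex.I / 2) • (X - Xᴴ) + (3 / 4 : ℂ) • (H * H)) * U) * (Uᴴ * Y)) := by
  have h1 : (Uᴴ * ((Complex.I / 2) • (X - Xᴴ) + (3 / 4 : ℂ) • (H * H)) * U) * (Uᴴ * Y) =
      Uᴴ * (((Complex.I / 2) • (X - Xᴴ) + (3 / 4 : ℂ) • (H * H)) * Y) := by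
    rw [Matrix.mul_assoc, ← Matrix.mul_assoc U, hU, Matrix.one_mul, Matrix.mul_assoc]
  have h2 : ((Complex.I / 2) • H * U)ᴴ = Uᴴ * ((-(Complex.I / 2)) • H) := by
    rw [Matrix.conjTranspose_mul, Matrix.conjTranspose_smul, hH]
    congr 2
    simp [neg_div]
  rw [h1, h2, hY, Matrix.mul_assoc, ← Matrix.mul_add, ← Matrix.mul_smul]
  simp only [Matrix.mul_add, Matrix.add_mul, Matrix.mul_sub, Matrix.sub_mul, Matrix.smul_mul,
    Matrix.mul_smul, Matrix.mul_assoc, smul_add, smul_sub, smul_smul]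
  match_scalars <;> ring_nf <;> simp <;> ring_nf

/-- Differentiating β'jβ^* = i I gives β''jβ^* = -H; substituting this in the expansion of β'' in
the rows of β' and β yields the equation. -/
theorem ae_deriv_relations (hβ : HasL2SecondDeriv T β β' β'')
    (h0 : ∀ x ∈ Icc (0 : ℝ) T, β x * jMat p * (β x)ᴴ = 0)
    (h1 : ∀ x ∈ Icc (0 : ℝ) T,
      β' x * jMat p * (β x)ᴴ = Complex.I • (1 : Matrix (Fin p) (Fin p) ℂ)) :
    ∀ᵐ x, x ∈ Ioo 0 T → HasDerivAt β' (β'' x) x ∧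
      β'' x = (Complex.I • (β' x * jMat p * (β' x)ᴴ)) * β' x +
        (Complex.I • (β'' x * jMat p * (β' x)ᴴ) +
          (β' x * jMat p * (β' x)ᴴ) * (β' x * jMat p * (β' x)ᴴ)) * β x := by
  filter_upwards [hβ.ae_hasDerivAt] with x hx hxT
  refine ⟨hx hxT, ?_⟩
  have hd := ((hx hxT).matrix_mul (hasDerivAt_const x (jMat p))).matrix_mul
    (hβ.hasDerivAt_fst hxT).matrix_conjTranspose
  have hc : HasDerivAt (fun y => β' y * jMat p * (β y)ᴴ) 0 x := by
    refine HasDerivAt.congr_of_eventuallyEq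
      (hasDerivAt_const x (Complex.I • (1 : Matrix (Fin p) (Fin p) ℂ))) ?_
    filter_upwards [Ioo_mem_nhds hxT.1 hxT.2] with y hy
    exact h1 y (Ioo_subset_Icc_self hy)
  have h2 := hd.unique hc
  rw [Matrix.mul_zero, zero_add] at h2
  have h3 : β'' x * jMat p * (β x)ᴴ = -(β' x * jMat p * (β' x)ᴴ) :=
    eq_neg_of_add_eq_zero_right h2
  have hxI := Ioo_subset_Icc_self hxT
  conv_lhs => rw [eq_mul_add_mul_of_jMat (h0 x hxI) (h1 x hxI) (β'' x), h3]
  simp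

end

section
variable {p : ℕ} {T : ℝ} {β β' β'' : ℝ → Matrix (Fin p) (Fin p ⊕ Fin p) ℂ}

theorem MeasureTheory.MemLp.bilinear_continuousOn {E F G : Type*} [NormedAddCommGroup E]
    [NormedSpace ℝ E] [NormedAddCommGroup F] [NormedSpace ℝ F] [NormedAddCommGroup G]
    [NormedSpace ℝ G] (B : E →L[ℝ] F →L[ℝ] G) {r : ENNReal} {a b : ℝ} {f : ℝ → E} {g : ℝ → F}
    (hf : MemLp f r (volume.restrict (Ioo a b))) (hg : ContinuousOn g (Icc a b)) :
    MemLp (fun x => B (f x) (g x)) r (volume.restrict (Ioo a b)) := by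
  obtain ⟨C, hC⟩ := isCompact_Icc.exists_bound_of_continuousOn hg
  refine hf.of_le_mul (c := ‖B‖ * C) (B.aestronglyMeasurable_comp₂ hf.1
    ((hg.mono Ioo_subset_Icc_self).aestronglyMeasurable measurableSet_Ioo)) ?_
  filter_upwards [ae_restrict_mem measurableSet_Ioo] with x hx
  refine (B.le_opNorm₂ _ _).trans ?_
  rw [mul_right_comm]
  gcongr
  exact hC x (Ioo_subset_Icc_self hx)

/-- X enters linearly and all other factors are bounded, so the potential inherits square
integrability from β''. -/
theorem memLp_gauged_potential {X H u : ℝ → Matrix (Fin p) (Fin p) ℂ}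
    (hX : MemLp X 2 (volume.restrict (Ioo 0 T))) (hH : ContinuousOn H (Icc 0 T))
    (hu : ContinuousOn u (Icc 0 T)) :
    MemLp (fun x => (u x)ᴴ * ((Complex.I / 2) • (X x - (X x)ᴴ) + (3 / 4 : ℂ) • (H x * H x)) * u x)
      2 (volume.restrict (Ioo 0 T)) := by
  have hstar : Continuous fun M : Matrix (Fin p) (Fin p) ℂ => Mᴴ :=
    Continuous.matrix_conjTranspose continuous_id
  have hXs : MemLp (fun x => (X x)ᴴ) 2 (volume.restrict (Ioo 0 T)) :=
    hX.of_le (hstar.comp_aestronglyMeasurable hX.1)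
      (ae_of_all _ fun x => (Matrix.l2_opNorm_conjTranspose _).le)
  have hHm : MemLp H 2 (volume.restrict (Ioo 0 T)) := by
    obtain ⟨C, hC⟩ := isCompact_Icc.exists_bound_of_continuousOn hH
    refine MemLp.of_bound
      ((hH.mono Ioo_subset_Icc_self).aestronglyMeasurable measurableSet_Ioo) C ?_
    filter_upwards [ae_restrict_mem measurableSet_Ioo] with x hx
    exact hC x (Ioo_subset_Icc_self hx)
  have h1 : MemLp (fun x => (Complex.I / 2) • (X x - (X x)ᴴ) + (3 / 4 : ℂ) • (H x * H x)) 2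
      (volume.restrict (Ioo 0 T)) :=
    ((hX.sub hXs).const_smul (Complex.I / 2)).add
      ((hHm.bilinear_continuousOn (matrixMulBilin _ _ _) hH).const_smul (3 / 4 : ℂ))
  exact (h1.bilinear_continuousOn (matrixMulBilin (Fin p) (Fin p) (Fin p)).flip
    (hstar.comp_continuousOn hu)).bilinear_continuousOn (matrixMulBilin _ _ _) hu

theorem AbsolutelyContinuousOnInterval.matrix_conjTranspose {m n : Type*} [Fintype m] [Fintype n]
    [DecidableEq m] [DecidableEq n] {f : ℝ → Matrix m n ℂ} {a b : ℝ}
    (hf : AbsolutelyContinuousOnInterval f a b) :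
    AbsolutelyContinuousOnInterval (fun x => (f x)ᴴ) a b :=
  hf.of_dist_le 1 fun x _ y _ => by
    rw [dist_eq_norm, dist_eq_norm, one_mul, ← Matrix.conjTranspose_sub,
      Matrix.l2_opNorm_conjTranspose]

theorem AbsolutelyContinuousOnInterval.matrix_mul {l m n : Type*} [Fintype l] [Fintype m]
    [Fintype n] [DecidableEq m] [DecidableEq n] {f : ℝ → Matrix l m ℂ} {g : ℝ → Matrix m n ℂ}
    {a b : ℝ} (hf : AbsolutelyContinuousOnInterval f a b)
    (hg : AbsolutelyContinuousOnInterval g a b) :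
    AbsolutelyContinuousOnInterval (fun x => f x * g x) a b :=
  AbsolutelyContinuousOnInterval.bilinear (matrixMulBilin l m n) hf hg

theorem AbsolutelyContinuousOnInterval.matrix_mul_const {l m n : Type*} [Fintype l] [Fintype m]
    [Fintype n] [DecidableEq m] [DecidableEq n] {f : ℝ → Matrix l m ℂ} (N : Matrix m n ℂ)
    {a b : ℝ} (hf : AbsolutelyContinuousOnInterval f a b) :
    AbsolutelyContinuousOnInterval (fun x => f x * N) a b :=
  hf.clm ((matrixMulBilin l m n).flip N)

theorem conjTranspose_mul_jMat_mul (b : Matrix (Fin p) (Fin p ⊕ Fin p) ℂ) :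
    (b * jMat p * bᴴ)ᴴ = b * jMat p * bᴴ := by
  rw [Matrix.conjTranspose_mul, Matrix.conjTranspose_mul, conjTranspose_jMat,
    Matrix.conjTranspose_conjTranspose, Matrix.mul_assoc]

/-- Since H is self-adjoint, (i/2)H is skew-adjoint and the solution starting from I stays unitary.
-/
theorem exists_unitary_gauge (hT : 0 ≤ T) {H : ℝ → Matrix (Fin p) (Fin p) ℂ}
    (hHs : ∀ x, (H x)ᴴ = H x) (hHc : ContinuousOn H (Icc 0 T)) :
    ∃ u : ℝ → Matrix (Fin p) (Fin p) ℂ,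
      (∀ x ∈ Icc (0 : ℝ) T, u x ∈ Matrix.unitaryGroup (Fin p) ℂ) ∧
      Continuous u ∧ AbsolutelyContinuousOnInterval u 0 T ∧
      ∀ x ∈ Icc (0 : ℝ) T, HasDerivAt u ((Complex.I / 2) • H x * u x) x := by
  -- H is extended by its end point values, so that the coefficient is continuous on the line.
  set G : ℝ → Matrix (Fin p) (Fin p) ℂ :=
    fun x => (Complex.I / 2) • IccExtend hT ((Icc 0 T).domRestrict H) x with hG
  have hGc : Continuous G := Continuous.fun_const_smul hHc.domRestrict.Icc_extend' _
  have hGH : ∀ x ∈ Icc 0 T, G x = (Complex.I / 2) • H x := by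
    intro x hx
    simp only [hG]
    rw [IccExtend_of_mem hT _ hx, domRestrict_apply]
  obtain ⟨u, hu0, ⟨v, hv, huv⟩, hud⟩ := exists_linear_ode_solution hT hGc
  have huu := star_mul_self_eq_one_of_skewAdjoint (G := G) (fun x hx => by
    rw [hGH x hx, Matrix.star_eq_conjTranspose, Matrix.conjTranspose_smul, hHs, ← neg_smul]
    simp [neg_div]) hu0 hud
  refine ⟨u, fun x hx => Matrix.mem_unitaryGroup_iff'.2 (huu x hx), ?_, ?_, fun x hx => ?_⟩
  · rw [funext huv]
    exact continuous_const.add (intervalIntegral.continuous_primitive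
      (fun a b => hv.intervalIntegrable a b) 0)
  · exact (AbsolutelyContinuousOnInterval.integral (hv.intervalIntegrable 0 T)
      left_mem_uIcc).of_dist_le 1 fun x _ y _ => by
        rw [huv x, huv y, dist_add_left, one_mul]
  · rw [← hGH x hx]
    exact hud x hx

end

/-! ### The Volterra equation of the gauged kernel -/

section
variable {p : ℕ} {T : ℝ}

theorem hasDerivAt_gauged {u H : ℝ → Matrix (Fin p) (Fin p) ℂ} {X Y₁' : Matrix (Fin p) (Fin p) ℂ}
    {Y Y₁ : ℝ → Matrix (Fin p) (Fin p) ℂ} {s x : ℝ}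
    (hu : HasDerivAt u ((Complex.I / 2) • H s * u s) s)
    (hH : HasDerivAt H (X + Xᴴ) s) (hY : HasDerivAt Y (Y₁ s) s) (hY₁ : HasDerivAt Y₁ Y₁' s)
    (hU : u s * (u s)ᴴ = 1) (hHs : (H s)ᴴ = H s)
    (hrel : Y₁' = (Complex.I • H s) * Y₁ s + (Complex.I • X + H s * H s) * Y s) :
    HasDerivAt (fun s => (u s)ᴴ *
        (Y s + ((x - s : ℝ) : ℂ) • (Y₁ s - (Complex.I / 2) • (H s * Y s))))
      (((x - s : ℝ) : ℂ) • (((u s)ᴴ * ((Complex.I / 2) • (X - Xᴴ) + (3 / 4 : ℂ) • (H s * H s)) *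
        u s) * ((u s)ᴴ * Y s))) s := by
  rw [← gauge_derivative_identity _ hU hHs hrel]
  refine hu.matrix_conjTranspose.matrix_mul (hY.add ?_)
  have hlin : HasDerivAt (fun s : ℝ => ((x - s : ℝ) : ℂ)) (-1) s := by
    have := ((hasDerivAt_id s).const_sub x).ofReal_comp
    simpa using this
  refine hlin.smul (hY₁.sub (HasDerivAt.const_smul (Complex.I / 2) ?_))
  refine (hH.matrix_mul hY).congr_deriv rfl

/-- Taylor's formula with integral remainder for z(s) = u(s)^*K(s,t) between t and x, where z'' =
qz, followed by multiplication by u(t) on the right. -/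
theorem gauged_kernel_identity {β β' β'' : ℝ → Matrix (Fin p) (Fin p ⊕ Fin p) ℂ} (hT : 0 ≤ T)
    (hβ : HasL2SecondDeriv T β β' β'')
    (h0 : ∀ x ∈ Icc (0 : ℝ) T, β x * jMat p * (β x)ᴴ = 0)
    (h1 : ∀ x ∈ Icc (0 : ℝ) T,
      β' x * jMat p * (β x)ᴴ = Complex.I • (1 : Matrix (Fin p) (Fin p) ℂ))
    {u H X q : ℝ → Matrix (Fin p) (Fin p) ℂ}
    (hH : ∀ x, H x = β' x * jMat p * (β' x)ᴴ) (hX : ∀ x, X x = β'' x * jMat p * (β' x)ᴴ)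
    (hHac : AbsolutelyContinuousOnInterval H 0 T)
    (huU : ∀ x ∈ Icc 0 T, u x * (u x)ᴴ = 1) (huU' : ∀ x ∈ Icc 0 T, (u x)ᴴ * u x = 1)
    (huac : AbsolutelyContinuousOnInterval u 0 T)
    (hu : ∀ x ∈ Icc (0 : ℝ) T, HasDerivAt u ((Complex.I / 2) • H x * u x) x)
    (hq : ∀ x, q x = (u x)ᴴ * ((Complex.I / 2) • (X x - (X x)ᴴ) + (3 / 4 : ℂ) • (H x * H x)) * u x)
    (hqi : IntegrableOn q (Ioo 0 T)) {x t : ℝ} (ht : 0 ≤ t) (htx : t ≤ x) (hxT : x ≤ T) :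
    (u x)ᴴ * kernelK β x t * u t =
      kernelA p x t + ∫ s in t..x, ((x - s) • q s) * ((u s)ᴴ * kernelK β s t * u t) := by
  set N := jMat p * (β t)ᴴ with hN
  set Y : ℝ → Matrix (Fin p) (Fin p) ℂ := fun s => Complex.I • (β s * N) with hY
  set Y₁ : ℝ → Matrix (Fin p) (Fin p) ℂ := fun s => Complex.I • (β' s * N) with hY₁
  -- Ψ = z + (x-s)z', whose derivative is (x-s)z''. At s = x it equals z(x), at s = t it carries the
  -- initial data.
  set Ψ : ℝ → Matrix (Fin p) (Fin p) ℂ := fun s =>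
    (u s)ᴴ * (Y s + ((x - s : ℝ) : ℂ) • (Y₁ s - (Complex.I / 2) • (H s * Y s))) with hΨ
  have hK : ∀ s, kernelK β s t = Y s := fun s => by simp only [kernelK, hY, hN, Matrix.mul_assoc]
  have hYac : AbsolutelyContinuousOnInterval Y 0 T :=
    ((hβ.absolutelyContinuous hT).matrix_mul_const N).const_smul Complex.I
  have hY₁ac : AbsolutelyContinuousOnInterval Y₁ 0 T :=
    ((hβ.absolutelyContinuous_deriv hT).matrix_mul_const N).const_smul Complex.I
  have hlin : AbsolutelyContinuousOnInterval (fun s => ((x - s : ℝ) : ℂ)) 0 T :=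
    LipschitzOnWith.absolutelyContinuousOnInterval (K := 1)
      ((LipschitzWith.of_dist_le_mul fun a b => by
        rw [dist_eq_norm, ← Complex.ofReal_sub, Complex.norm_real, Real.dist_eq, Real.norm_eq_abs,
          abs_sub_comm a b]
        simp).lipschitzOnWith)
  have hΨac : AbsolutelyContinuousOnInterval Ψ 0 T :=
    huac.matrix_conjTranspose.matrix_mul
      (hYac.add (hlin.fun_smul (hY₁ac.sub ((hHac.matrix_mul hYac).const_smul (Complex.I / 2)))))
  have hsub : Icc t x ⊆ Icc 0 T := Icc_subset_Icc ht hxT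
  have hΨd : ∀ᵐ s, s ∈ uIcc t x →
      HasDerivAt Ψ (((x - s : ℝ) : ℂ) • (q s * ((u s)ᴴ * Y s))) s := by
    -- The points 0 and T are discarded, because β has two-sided derivatives only inside the
    -- interval.
    filter_upwards [ae_deriv_relations hβ h0 h1, measure_eq_zero_iff_ae_notMem.1
      (measure_singleton (μ := volume) (0 : ℝ)), measure_eq_zero_iff_ae_notMem.1
      (measure_singleton (μ := volume) T)] with s hs hs0 hsT hsm
    rw [uIcc_of_le htx] at hsm
    have hsI : s ∈ Icc 0 T := hsub hsm
    have hsO : s ∈ Ioo 0 T := ⟨lt_of_le_of_ne hsI.1 fun h => hs0 h.symm,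
      lt_of_le_of_ne hsI.2 hsT⟩
    obtain ⟨hd, hrel⟩ := hs hsO
    rw [hq]
    refine hasDerivAt_gauged (Y₁' := Complex.I • (β'' s * N)) (hu s hsI) ?_ ?_ ?_ (huU s hsI)
      (by rw [hH, conjTranspose_mul_jMat_mul]) ?_
    · have h2 := (hd.matrix_mul (hasDerivAt_const s (jMat p))).matrix_mul hd.matrix_conjTranspose
      rw [funext hH]
      refine h2.congr_deriv ?_
      rw [hX, Matrix.mul_zero, zero_add, add_comm, Matrix.conjTranspose_mul,
        Matrix.conjTranspose_mul, conjTranspose_jMat, Matrix.conjTranspose_conjTranspose,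
        Matrix.mul_assoc (β' s)]
    · have h2 := ((hβ.hasDerivAt_fst hsO).matrix_mul (hasDerivAt_const s N)).const_smul Complex.I
      refine h2.congr_deriv ?_
      rw [Matrix.mul_zero, zero_add]
    · have h2 := (hd.matrix_mul (hasDerivAt_const s N)).const_smul Complex.I
      refine h2.congr_deriv ?_
      rw [Matrix.mul_zero, zero_add]
    · rw [← hH, ← hX] at hrel
      conv_lhs => rw [hrel]
      simp only [hY, hY₁, Matrix.add_mul, Matrix.mul_smul, Matrix.mul_assoc, smul_add]
  have hcont : ∀ {f : ℝ → Matrix (Fin p) (Fin p) ℂ}, AbsolutelyContinuousOnInterval f 0 T →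
      ContinuousOn f (Icc 0 T) := fun hf => by
    have := hf.continuousOn
    rwa [uIcc_of_le hT] at this
  have hΨi : IntervalIntegrable (fun s => ((x - s : ℝ) : ℂ) • (q s * ((u s)ᴴ * Y s)))
      volume t x := by
    have h2 : IntegrableOn q (Icc t x) := by
      rw [integrableOn_Icc_iff_integrableOn_Ioo]
      exact hqi.mono_set (Ioo_subset_Ioo ht hxT)
    have h3 := h2.mul_continuousOn ((hcont (huac.matrix_conjTranspose.matrix_mul hYac)).mono hsub)
      isCompact_Icc
    have h4 := h3.continuousOn_smul (f := fun s => ((x - s : ℝ) : ℂ)) (by fun_prop) isCompact_Icc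
    rw [intervalIntegrable_iff_integrableOn_Icc_of_le htx]
    exact h4
  have hfin := (hΨac.mono (by rw [uIcc_of_le htx, uIcc_of_le hT]; exact hsub)
    ).integral_eq_sub_of_ae_hasDerivAt hΨi hΨd
  have htI : t ∈ Icc 0 T := ⟨ht, htx.trans hxT⟩
  have hΨx : Ψ x = (u x)ᴴ * kernelK β x t := by
    simp only [hΨ, hK, sub_self, Complex.ofReal_zero, zero_smul, add_zero]
  -- The two hypotheses on β at the point t are the initial conditions Y(t) = 0 and Y'(t) = -I;
  -- unitarity of u(t) then removes the gauge.
  have hΨt : Ψ t * u t = kernelA p x t := by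
    have h2 : Y t = 0 := by
      simp only [hY, hN]
      rw [← Matrix.mul_assoc, h0 t htI, smul_zero]
    have h3 : Y₁ t = -1 := by
      simp only [hY₁, hN]
      rw [← Matrix.mul_assoc, h1 t htI, smul_smul, Complex.I_mul_I, neg_one_smul]
    simp only [hΨ]
    rw [h2, h3, Matrix.mul_zero, smul_zero, sub_zero, zero_add, Matrix.mul_smul, Matrix.smul_mul,
      Matrix.mul_neg, Matrix.mul_one, Matrix.neg_mul, huU' t htI, kernelA, smul_neg,
      ← neg_smul, ← Complex.ofReal_neg, neg_sub]
  have hint : ∫ s in t..x, ((x - s) • q s) * ((u s)ᴴ * kernelK β s t * u t) =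
      (∫ s in t..x, ((x - s : ℝ) : ℂ) • (q s * ((u s)ᴴ * Y s))) * u t := by
    have h2 := ((matrixMulBilin (Fin p) (Fin p) (Fin p)).flip (u t)).intervalIntegral_comp_comm hΨi
    refine Eq.trans (intervalIntegral.integral_congr fun s _ => ?_) h2
    change ((x - s) • q s) * ((u s)ᴴ * kernelK β s t * u t) =
      (((x - s : ℝ) : ℂ) • (q s * ((u s)ᴴ * Y s))) * u t
    rw [hK, Complex.coe_smul, Matrix.smul_mul, Matrix.smul_mul, Matrix.mul_assoc (q s)]
  rw [hint, hfin, Matrix.sub_mul, hΨt, hΨx]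
  abel

/-- After conjugation by a unitary gauge `u`, the kernel of `K` satisfies the integral equation
`k(x,t) = (t - x) I_p + ∫_t^x (x - s) q(s) k(s,t) ds` with a potential `q` in `L_2(0,T)`. -/
theorem exists_gauged_kernel {β β' β'' : ℝ → Matrix (Fin p) (Fin p ⊕ Fin p) ℂ} (hT : 0 ≤ T)
    (hβ : HasL2SecondDeriv T β β' β'')
    (h0 : ∀ x ∈ Icc (0 : ℝ) T, β x * jMat p * (β x)ᴴ = 0)
    (h1 : ∀ x ∈ Icc (0 : ℝ) T,
      β' x * jMat p * (β x)ᴴ = Complex.I • (1 : Matrix (Fin p) (Fin p) ℂ)) :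
    ∃ u q : ℝ → Matrix (Fin p) (Fin p) ℂ, (∀ x ∈ Icc 0 T, u x ∈ Matrix.unitaryGroup (Fin p) ℂ) ∧
      Continuous u ∧ AbsolutelyContinuousOnInterval u 0 T ∧
      MemLp q 2 (volume.restrict (Ioo 0 T)) ∧
      ∀ x t, 0 ≤ t → t ≤ x → x ≤ T → (u x)ᴴ * kernelK β x t * u t =
        kernelA p x t + ∫ s in t..x, ((x - s) • q s) * ((u s)ᴴ * kernelK β s t * u t) := by
  have hd := hβ.absolutelyContinuous_deriv hT
  have hcont : ∀ {m n : Type} [Fintype m] [Fintype n] [DecidableEq m] [DecidableEq n]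
      {f : ℝ → Matrix m n ℂ}, AbsolutelyContinuousOnInterval f 0 T → ContinuousOn f (Icc 0 T) :=
    fun hf => by
      have := hf.continuousOn
      rwa [uIcc_of_le hT] at this
  have hH : AbsolutelyContinuousOnInterval (fun x => β' x * jMat p * (β' x)ᴴ) 0 T :=
    (hd.matrix_mul_const _).matrix_mul hd.matrix_conjTranspose
  have hX : MemLp (fun x => β'' x * jMat p * (β' x)ᴴ) 2 (volume.restrict (Ioo 0 T)) :=
    (hβ.memLp_matrix.bilinear_continuousOn (matrixMulBilin _ _ _)
      (continuousOn_const (c := jMat p))).bilinear_continuousOn (matrixMulBilin _ _ _)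
        (hcont hd.matrix_conjTranspose)
  obtain ⟨u, hU, huc, huac, hu⟩ := exists_unitary_gauge hT
    (H := fun x => β' x * jMat p * (β' x)ᴴ) (fun x => conjTranspose_mul_jMat_mul _) (hcont hH)
  have hq := memLp_gauged_potential hX (hcont hH) huc.continuousOn
  exact ⟨u, _, hU, huc, huac, hq, fun x t ht htx hxT => gauged_kernel_identity hT hβ h0 h1
    (fun _ => rfl) (fun _ => rfl) hH (fun x hx => Matrix.mem_unitaryGroup_iff.1 (hU x hx))
    (fun x hx => Matrix.mem_unitaryGroup_iff'.1 (hU x hx)) huac hu (fun _ => rfl)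
    (hq.integrable (by norm_num)) ht htx hxT⟩

end

/-! ### Invertibility of I + W and multiplication operators -/

section
variable {p : ℕ} {T : ℝ} {k : ℝ → ℝ → Matrix (Fin p) (Fin p) ℂ}

/-- The classical iterated Volterra estimate. The exponent n + 1 leaves one application for passing
from the L¹ norm to a pointwise bound. -/
theorem norm_volterraOp_pow_apply_le (hk : IsBddKernel T k) {C : ℝ}
    (hC : ∀ x t : ℝ, 0 ≤ t → t ≤ x → x ≤ T → ‖k x t‖ ≤ C) (f : L2vec p T) (n : ℕ) :
    ∀ᵐ x ∂(volume.restrict (Ioo (0 : ℝ) T)), ‖(volterraOp T k hk ^ (n + 1)) f x‖ ≤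
      |C| ^ (n + 1) * (x ^ n / n.factorial) * ∫ t in Ioo (0 : ℝ) T, ‖f t‖ := by
  induction n with
  | zero =>
    filter_upwards [volterraOp_coeFn hk f, ae_restrict_mem measurableSet_Ioo] with x hx hxI
    rw [zero_add, pow_one, pow_one, hx, pow_zero, Nat.factorial_zero, Nat.cast_one, div_one,
      mul_one]
    exact norm_volterraFun_le_integral hC (L2vec_integrable f) (Ioo_subset_Icc_self hxI)
  | succ n ih =>
    set M := ∫ t in Ioo (0 : ℝ) T, ‖f t‖ with hM
    rw [ae_restrict_iff' measurableSet_Ioo] at ih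
    rw [pow_succ']
    filter_upwards [volterraOp_coeFn hk ((volterraOp T k hk ^ (n + 1)) f),
      ae_restrict_mem measurableSet_Ioo] with x hx hxI
    rw [mul_apply_eq_comp, hx, volterraFun]
    have hint : ∫ t in (0 : ℝ)..x, |C| * (|C| ^ (n + 1) * (t ^ n / n.factorial) * M) =
        |C| ^ (n + 1 + 1) * (x ^ (n + 1) / (n + 1).factorial) * M := by
      have h2 : ∀ t : ℝ, |C| * (|C| ^ (n + 1) * (t ^ n / n.factorial) * M) =
          (|C| ^ (n + 1 + 1) * M / n.factorial) * t ^ n := fun t => by ring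
      simp only [h2]
      rw [intervalIntegral.integral_const_mul, integral_pow, Nat.factorial_succ, zero_pow (by simp)]
      have := Nat.factorial_pos n
      push_cast
      field_simp
      ring
    rw [← hint]
    refine intervalIntegral.norm_integral_le_of_norm_le hxI.1.le ?_
      (Continuous.intervalIntegrable (by fun_prop) _ _)
    filter_upwards [ih] with t ht htx
    have htI : t ∈ Ioo 0 T := ⟨htx.1, htx.2.trans_lt hxI.2⟩
    refine (norm_toEuclideanLin_le _ _).trans ?_
    gcongr
    · exact (hC x t htx.1.le htx.2 hxI.2.le).trans (le_abs_self C)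
    · exact ht htI

theorem exists_norm_volterraOp_pow_lt_one (hT : 0 ≤ T) (hk : IsBddKernel T k) :
    ∃ n : ℕ, ‖volterraOp T k hk ^ n‖ < 1 := by
  obtain ⟨C, hC⟩ := hk.bounded
  set m := (volume (Ioo (0 : ℝ) T)).toReal ^ (1 / 2 : ℝ) with hm
  have hm0 : 0 ≤ m := by positivity
  have hbound : ∀ n : ℕ, ‖volterraOp T k hk ^ (n + 1)‖ ≤
      m * (|C| * m) * ((|C| * T) ^ n / n.factorial) := by
    intro n
    refine ContinuousLinearMap.opNorm_le_bound _ (by positivity) fun f => ?_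
    have h := Lp.norm_le_of_ae_bound (p := 2) (f := (volterraOp T k hk ^ (n + 1)) f)
      (C := |C| ^ (n + 1) * (T ^ n / n.factorial) * (m * ‖f‖)) (by positivity) (by
        filter_upwards [norm_volterraOp_pow_apply_le hk hC f n,
          ae_restrict_mem measurableSet_Ioo] with x hx hxI
        refine hx.trans ?_
        have := hxI.1.le
        have := hxI.2.le
        gcongr
        exact integral_norm_L2vec_le f)
    refine h.trans (le_of_eq ?_)
    simp only [measureUnivNNReal, ENNReal.coe_toNNReal_eq_toReal, Measure.restrict_apply_univ]
    rw [show ((2 : ENNReal).toReal⁻¹) = (1 / 2 : ℝ) by norm_num, ← hm, mul_pow]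
    ring
  have hlim : Filter.Tendsto (fun n : ℕ => m * (|C| * m) * ((|C| * T) ^ n / n.factorial))
      Filter.atTop (nhds 0) := by
    simpa using (FloorSemiring.tendsto_pow_div_factorial_atTop (|C| * T)).const_mul (m * (|C| * m))
  obtain ⟨n, hn⟩ := (hlim.eventually_lt_const one_pos).exists
  exact ⟨n + 1, (hbound n).trans_lt hn⟩

/-- The element 1 - (-a)^n is a unit by the Neumann series, and 1 + a is one of its factors,
commuting with the complementary geometric sum. -/
theorem isUnit_one_add_of_norm_pow_lt_one {R : Type*} [NormedRing R] [HasSummableGeomSeries R]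
    {a : R} {n : ℕ} (h : ‖a ^ n‖ < 1) : IsUnit (1 + a) := by
  have h1 : ‖(-a) ^ n‖ < 1 := by
    rcases n.even_or_odd with h2 | h2
    · rwa [h2.neg_pow]
    · rwa [h2.neg_pow, norm_neg]
  have h2 : IsUnit (1 - (-a) ^ n) := (Units.oneSub _ h1).isUnit
  rw [← mul_neg_geom_sum, sub_neg_eq_add] at h2
  refine ((Commute.sum_right _ _ _ fun i _ => ?_).isUnit_mul_iff.1 h2).1
  exact ((Commute.one_left _).add_left (Commute.refl a)).neg_right.pow_right i

theorem isUnit_one_add_volterraOp (hT : 0 ≤ T) (hk : IsBddKernel T k) :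
    IsUnit (1 + volterraOp T k hk) :=
  let ⟨_, hn⟩ := exists_norm_volterraOp_pow_lt_one hT hk
  isUnit_one_add_of_norm_pow_lt_one hn

/-- Multiplication by a continuous matrix function is a bounded operator on `L_2^p(0,T)`. -/
theorem exists_multiplication_operator (T : ℝ) {u : ℝ → Matrix (Fin p) (Fin p) ℂ}
    (hu : Continuous u) : ∃ U : L2vec p T →L[ℂ] L2vec p T, ∀ f,
      U f =ᵐ[volume.restrict (Ioo (0 : ℝ) T)] fun x => Matrix.toEuclideanLin (u x) (f x) := by
  obtain ⟨C, hC⟩ := isCompact_Icc.exists_bound_of_continuousOn (s := Icc 0 T) hu.continuousOn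
  have hm : MemLp u ⊤ (volume.restrict (Ioo (0 : ℝ) T)) := memLp_top_of_bound
    hu.aestronglyMeasurable C (by
      filter_upwards [ae_restrict_mem measurableSet_Ioo] with x hx
      exact hC x (Ioo_subset_Icc_self hx))
  refine ⟨(mulVecBilin p).holderL (volume.restrict (Ioo (0 : ℝ) T)) ⊤ 2 2 hm.toLp, fun f => ?_⟩
  filter_upwards [(mulVecBilin p).coeFn_holder (r := 2) hm.toLp f, hm.coeFn_toLp] with x hx hx2
  rw [ContinuousLinearMap.holderL_apply_apply, hx, hx2]
  rfl

theorem exists_unitary_multiplication_equiv {u : ℝ → Matrix (Fin p) (Fin p) ℂ}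
    (hu : Continuous u) (hU : ∀ x ∈ Icc (0 : ℝ) T, u x ∈ Matrix.unitaryGroup (Fin p) ℂ) :
    ∃ U : L2vec p T ≃L[ℂ] L2vec p T, ∀ f,
      U f =ᵐ[volume.restrict (Ioo (0 : ℝ) T)] fun x => Matrix.toEuclideanLin (u x) (f x) := by
  obtain ⟨U, hUf⟩ := exists_multiplication_operator T hu
  obtain ⟨U', hUf'⟩ := exists_multiplication_operator T hu.matrix_conjTranspose
  have hmul : ∀ (A B : Matrix (Fin p) (Fin p) ℂ) (v : EuclideanSpace ℂ (Fin p)), A * B = 1 →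
      Matrix.toEuclideanLin A (Matrix.toEuclideanLin B v) = v := by
    intro A B v h
    simp [Matrix.toLpLin_apply, h]
  refine ⟨ContinuousLinearEquiv.equivOfInverse U U' (fun f => Lp.ext ?_) (fun f => Lp.ext ?_), hUf⟩
  · filter_upwards [hUf f, hUf' (U f), ae_restrict_mem measurableSet_Ioo] with x h1 h2 hx
    rw [h2, h1, hmul]
    exact Matrix.mem_unitaryGroup_iff'.1 (hU x (Ioo_subset_Icc_self hx))
  · filter_upwards [hUf' f, hUf (U' f), ae_restrict_mem measurableSet_Ioo] with x h1 h2 hx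
    rw [h2, h1, hmul]
    exact Matrix.mem_unitaryGroup_iff.1 (hU x (Ioo_subset_Icc_self hx))

theorem IsBddKernel.mul_mul (hk : IsBddKernel T k) {a b : ℝ → Matrix (Fin p) (Fin p) ℂ}
    (ha : Continuous a) (hb : Continuous b) : IsBddKernel T (fun x t => a x * k x t * b t) := by
  refine ⟨((ha.comp continuous_fst).aestronglyMeasurable.mul hk.aestronglyMeasurable).mul
    (hb.comp continuous_snd).aestronglyMeasurable, ?_⟩
  obtain ⟨C, hC⟩ := hk.bounded
  obtain ⟨Ca, hCa⟩ := isCompact_Icc.exists_bound_of_continuousOn (s := Icc 0 T) ha.continuousOn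
  obtain ⟨Cb, hCb⟩ := isCompact_Icc.exists_bound_of_continuousOn (s := Icc 0 T) hb.continuousOn
  refine ⟨Ca * C * Cb, fun x t ht htx hxT => ?_⟩
  have h1 := hCa x ⟨ht.trans htx, hxT⟩
  have h2 := hCb t ⟨ht, htx.trans hxT⟩
  have h3 := hC x t ht htx hxT
  have h4 := (norm_nonneg _).trans h1
  have h5 := (norm_nonneg _).trans h3
  exact (norm_mul_le _ _).trans (mul_le_mul ((norm_mul_le _ _).trans
    (mul_le_mul h1 h3 (norm_nonneg _) h4)) h2 (norm_nonneg _) (mul_nonneg h4 h5))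

theorem volterraFun_congr_ae {f g : ℝ → EuclideanSpace ℂ (Fin p)}
    (h : f =ᵐ[volume.restrict (Ioo (0 : ℝ) T)] g) {x : ℝ} (hx : x ∈ Ioo 0 T) :
    volterraFun k f x = volterraFun k g x := by
  rw [volterraFun_eq hx, volterraFun_eq hx]
  refine integral_congr_ae ?_
  filter_upwards [h] with t ht
  simp only [indicator, ht]

end

/-! ### Assembly of the similarity -/

/-- A pointwise gauge relation between two kernels passes to the operators: multiplication by u
carries the operator with kernel k' to that with kernel k, because u(x) may be pulled out of the
integral. -/
theorem volterraFun_multiplication {p : ℕ} {T : ℝ} {k k' : ℝ → ℝ → Matrix (Fin p) (Fin p) ℂ}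
    {u : ℝ → Matrix (Fin p) (Fin p) ℂ} (hk' : IsBddKernel T k')
    (h : ∀ x t, 0 ≤ t → t ≤ x → x ≤ T → k x t * u t = u x * k' x t) (g : L2vec p T)
    {F : ℝ → EuclideanSpace ℂ (Fin p)} (hF : F =ᵐ[volume.restrict (Ioo (0 : ℝ) T)]
      fun x => Matrix.toEuclideanLin (u x) (g x)) :
    ∀ᵐ x ∂(volume.restrict (Ioo (0 : ℝ) T)),
      volterraFun k F x = Matrix.toEuclideanLin (u x) (volterraFun k' g x) := by
  filter_upwards [integrable_indicator_kernel hk' g, ae_restrict_mem measurableSet_Ioo]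
    with x hx hxI
  rw [volterraFun_eq hxI, volterraFun_eq hxI]
  refine Eq.trans (integral_congr_ae ?_) ((mulVecBilin p (u x)).integral_comp_comm hx)
  filter_upwards [hF] with t ht
  change _ = Matrix.toEuclideanLin (u x) _
  by_cases hz : (x, t) ∈ triangle T
  · rw [indicator_of_mem hz, indicator_of_mem hz]
    simp [ht, Matrix.toLpLin_apply, h x t hz.1 hz.2.1 hz.2.2]
  · rw [indicator_of_notMem hz, indicator_of_notMem hz, map_zero]

/-- For `β` with values in the `p × 2p` matrices, two times differentiable with `β''` in
`L_2(0,T)`, `β j β^* = 0` and `β' j β^* = i I_p` on `[0,T]`, the operator `K` is similar to `A`,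
`K = V A V⁻¹`, where `V = u(x) (I + ∫_0^x 𝒱(x,t) · dt)` with `u` unitary and absolutely continuous
on `[0,T]`, and `𝒱` bounded on the triangle `0 ≤ t ≤ x ≤ T`. -/
theorem theoremC1 (p : ℕ) (T : ℝ) (hT : 0 < T)
    (β β' β'' : ℝ → Matrix (Fin p) (Fin p ⊕ Fin p) ℂ)
    (hβ : HasL2SecondDeriv T β β' β'')
    (h0 : ∀ x ∈ Icc (0 : ℝ) T, β x * jMat p * (β x)ᴴ = 0)
    (h1 : ∀ x ∈ Icc (0 : ℝ) T,
      β' x * jMat p * (β x)ᴴ = Complex.I • (1 : Matrix (Fin p) (Fin p) ℂ)) :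
    ∃ (u : ℝ → Matrix (Fin p) (Fin p) ℂ) (𝒱 : ℝ → ℝ → Matrix (Fin p) (Fin p) ℂ)
      (V : L2vec p T ≃L[ℂ] L2vec p T),
      (∀ x ∈ Icc (0 : ℝ) T, u x ∈ Matrix.unitaryGroup (Fin p) ℂ) ∧
      (∀ a b, AbsolutelyContinuousOnInterval (fun x => u x a b) 0 T) ∧
      IsBddKernel T 𝒱 ∧
      (∀ f : L2vec p T, V f =ᵐ[volume.restrict (Ioo (0 : ℝ) T)]
        fun x => Matrix.toEuclideanLin (u x)
          (f x + ∫ t in (0 : ℝ)..x, Matrix.toEuclideanLin (𝒱 x t) (f t))) ∧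
      opK T β hβ.continuousOn =
        (V : L2vec p T →L[ℂ] L2vec p T) ∘L opA p T ∘L (V.symm : L2vec p T →L[ℂ] L2vec p T) := by
  obtain ⟨u, q, hU, huc, huac, hq, hkq⟩ := exists_gauged_kernel hT.le hβ h0 h1
  have hkt : IsBddKernel T fun x t => (u x)ᴴ * kernelK β x t * u t :=
    (isBddKernel_kernelK hβ.continuousOn).mul_mul huc.matrix_conjTranspose huc
  obtain ⟨W, hW, hWk⟩ := exists_intertwining_kernel hT.le (hq.integrable (by norm_num))
    ((memLp_two_iff_integrable_sq_norm hq.1).1 hq) hkt hkq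
  obtain ⟨U, hUf⟩ := exists_unitary_multiplication_equiv huc hU
  obtain ⟨N, hN⟩ := isUnit_one_add_volterraOp hT.le hW
  have hNf : ∀ f : L2vec p T, (N : L2vec p T →L[ℂ] L2vec p T) f
      =ᵐ[volume.restrict (Ioo (0 : ℝ) T)] fun x => f x + volterraFun W f x := by
    intro f
    rw [hN]
    filter_upwards [Lp.coeFn_add f (volterraOp T W hW f), volterraOp_coeFn hW f] with x hx hx2
    rw [← hx2]
    exact hx
  -- V is I + W followed by multiplication by u.
  have hVf : ∀ f : L2vec p T, ((ContinuousLinearEquiv.ofUnit N).trans U) f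
      =ᵐ[volume.restrict (Ioo (0 : ℝ) T)]
        fun x => Matrix.toEuclideanLin (u x) (f x + volterraFun W f x) := by
    intro f
    filter_upwards [hUf ((N : L2vec p T →L[ℂ] L2vec p T) f), hNf f] with x hx hx2
    rw [← hx2]
    exact hx
  refine ⟨u, W, (ContinuousLinearEquiv.ofUnit N).trans U, hU, fun a b => huac.of_dist_le 1
    fun x _ y _ => ?_, hW, hVf, ?_⟩
  · rw [dist_eq_norm, dist_eq_norm, one_mul]
    exact norm_matrix_entry_le (u x - u y) a b
  set V := (ContinuousLinearEquiv.ofUnit N).trans U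
  -- KV = VA is proved first: K passes through u and becomes the gauged kernel, which I + W
  -- intertwines with A. The similarity follows on inserting V⁻¹f.
  have hKV : ∀ f, opK T β hβ.continuousOn (V f) = V (opA p T f) := by
    intro f
    have hmul : ∀ x t, 0 ≤ t → t ≤ x → x ≤ T →
        kernelK β x t * u t = u x * ((u x)ᴴ * kernelK β x t * u t) := by
      intro x t ht htx hxT
      have huu : u x * (u x)ᴴ = 1 := Matrix.mem_unitaryGroup_iff.1 (hU x ⟨ht.trans htx, hxT⟩)
      rw [← Matrix.mul_assoc, ← Matrix.mul_assoc, huu, Matrix.one_mul]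
    have hA := volterraOp_coeFn (isBddKernel_kernelA p T) f
    refine Lp.ext ?_
    filter_upwards [volterraOp_coeFn (isBddKernel_kernelK hβ.continuousOn) (V f),
      hVf (opA p T f), volterraFun_multiplication hkt hmul _ (hUf (N.val f)), hA,
      ae_restrict_mem measurableSet_Ioo] with x hK hV hm hAx hxI
    refine hK.trans (hm.trans ?_)
    rw [hV, volterraFun_congr_ae (hNf f) hxI, hWk f (L2vec_integrable f) x hxI, ← hAx,
      ← volterraFun_congr_ae hA hxI]
    rfl
  ext1 f
  have h2 := hKV (V.symm f)
  rwa [ContinuousLinearEquiv.apply_symm_apply] at h2
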